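/- Let $p\ge 5$ be a prime. Every elliptic curve over $\mathbb{Q}$ is isomorphic to a unique curve $E_{A,B}: y^2=x^3+Ax+B$ with $A,B\in\mathbb{Z}$, $4A^3+27B^2\neq 0$ and $\gcd(A^3,B^2)$ not divisible by $n^{12}$ for any integer $n>1$; its height is $H(E)=\max(|A|^3,|B|^2)$. Let $\mathcal{E}(X)$ be the set of isomorphism classes of elliptic curves over $\mathbb{Q}$ of height $<X$. For a prime $l$ let $c_l(E)=[E(\mathbb{Q}_l):E_0(\mathbb{Q}_l)]$ be the Tamagawa number, where $E_0(\mathbb{Q}_l)$ is the group of points with nonsingular reduction on a minimal Weierstrass equation of $E$ over $\mathbb{Z}_l$, and put $\tau_p(E)=\prod_{l} p^{v_p(c_l(E))}$, the product being over all primes $l$. If $E=E_{A,B}$ has good reduction at $p$, i.e. $p\nmid 4A^3+27B^2$, let $\widetilde{E}: y^2=x^3+\bar Ax+\bar B$ be the reduced curve over $\mathbb{F}_p$ and $\delta_p(E)=\#\widetilde{E}(\mathbb{F}_p)[p]$. Let $\mathcal{E}_2(X)$ be the set of $E\in\mathcal{E}(X)$ with $p\mid\tau_p(E)$, and let $\mathcal{E}_3(X)$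 be the set of $E\in\mathcal{E}(X)$ that have good reduction at $p$ and satisfy $p\mid\delta_p(E)$. Put $$\mathfrak{d}_p^{(i)}=\limsup_{X\to\infty}\frac{\#\mathcal{E}_i(X)}{\#\mathcal{E}(X)}\qquad(i=2,3).$$ Let $d(p)$ be the number of pairs $(a,b)\in\mathbb{F}_p\times\mathbb{F}_p$ with $4a^3+27b^2\neq0$ such that $y^2=x^3+ax+b$ has an $\mathbb{F}_p$-point of order $p$. Then $$\mathfrak{d}_p^{(2)}\le\sum_{l\neq p}\frac{(l-1)^2}{l^{p+2}},$$ where the sum is over the primes $l\ne p$ (and converges), and $$\mathfrak{d}_p^{(3)}\le\zeta(10)\cdot\frac{d(p)}{p^2}.$$ -/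

import Mathlib

open Filter

noncomputable section

namespace EllipticDensity

open WeierstrassCurve

/-! ### Short Weierstrass equations and isomorphism classes of elliptic curves over `ℚ` -/

/-- The Weierstrass curve `y² = x³ + a x + b` over a commutative ring. -/
def shortCurve {R : Type*} [CommRing R] (a b : R) : WeierstrassCurve R := ⟨0, 0, 0, a, b⟩

/-- `y² = x³ + A x + B` is an elliptic curve over `ℚ` and `gcd (A³, B²)` is not divisible by any
twelfth power (other than `1`). -/
def IsMinimalPair (A B : ℤ) : Prop :=
  4 * A ^ 3 + 27 * B ^ 2 ≠ 0 ∧ ∀ n : ℕ, 1 < n → ¬ n ^ 12 ∣ Int.gcd (A ^ 3) (B ^ 2)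

theorem shortCurve_Δ {R : Type*} [CommRing R] (a b : R) :
    (shortCurve a b).Δ = -16 * (4 * a ^ 3 + 27 * b ^ 2) := by
  simp only [shortCurve, WeierstrassCurve.Δ, WeierstrassCurve.b₂, WeierstrassCurve.b₄,
    WeierstrassCurve.b₆, WeierstrassCurve.b₈]
  ring

theorem isElliptic_shortCurve_iff (A B : ℤ) :
    (shortCurve (A : ℚ) (B : ℚ)).IsElliptic ↔ 4 * A ^ 3 + 27 * B ^ 2 ≠ 0 := by
  rw [WeierstrassCurve.isElliptic_iff, shortCurve_Δ, isUnit_iff_ne_zero]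
  have : (4 * (A : ℚ) ^ 3 + 27 * (B : ℚ) ^ 2) ≠ 0 ↔ 4 * A ^ 3 + 27 * B ^ 2 ≠ 0 := by
    exact_mod_cast Iff.rfl
  rw [← this]
  simp

/-- Scaling the coordinates of a short Weierstrass curve. -/
theorem scale_shortCurve {K : Type*} [Field K] (v : Kˣ) (a b : K) :
    (⟨v⁻¹, 0, 0, 0⟩ : VariableChange K) • shortCurve a b =
      shortCurve ((v : K) ^ 4 * a) ((v : K) ^ 6 * b) := by
  simp [shortCurve, variableChange_def]

/-- A twelfth power divides `gcd (A³, B²)` iff the fourth power divides `A` and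
the sixth power divides `B`. -/
theorem pow_dvd_gcd_iff (A B : ℤ) (n : ℕ) :
    n ^ 12 ∣ Int.gcd (A ^ 3) (B ^ 2) ↔ (n : ℤ) ^ 4 ∣ A ∧ (n : ℤ) ^ 6 ∣ B := by
  rw [Int.dvd_gcd_iff, ← Int.pow_dvd_pow_iff (n := 3) (a := (n : ℤ) ^ 4) (by norm_num),
    ← Int.pow_dvd_pow_iff (n := 2) (a := (n : ℤ) ^ 6) (by norm_num)]
  push_cast
  rw [← pow_mul, ← pow_mul]

/-- Every elliptic curve over `ℚ` has an integral short Weierstrass equation. -/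
theorem exists_integral_short (W : WeierstrassCurve ℚ) :
    ∃ A B : ℤ, ∃ C : VariableChange ℚ, C • W = shortCurve (A : ℚ) (B : ℚ) := by
  have : Invertible (2 : ℚ) := invertibleOfNonzero (by norm_num)
  have : Invertible (3 : ℚ) := invertibleOfNonzero (by norm_num)
  obtain ⟨C, hC⟩ := W.exists_variableChange_isShortNF
  obtain ⟨a, b, hab⟩ : ∃ a b : ℚ, C • W = shortCurve a b :=
    ⟨(C • W).a₄, (C • W).a₆, by
      ext <;> simp [shortCurve]⟩
  have ha : (a.den : ℚ) ≠ 0 := by exact_mod_cast a.den_nz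
  have hb : (b.den : ℚ) ≠ 0 := by exact_mod_cast b.den_nz
  refine ⟨a.num * a.den ^ 3 * b.den ^ 4, b.num * a.den ^ 6 * b.den ^ 5,
    ⟨(Units.mk0 ((a.den : ℚ) * b.den) (mul_ne_zero ha hb))⁻¹, 0, 0, 0⟩ * C, ?_⟩
  rw [mul_smul, hab, scale_shortCurve]
  have h1 : (a.num : ℚ) = a * a.den := (Rat.mul_den_eq_num a).symm
  have h2 : (b.num : ℚ) = b * b.den := (Rat.mul_den_eq_num b).symm
  push_cast
  rw [h1, h2, Units.val_mk0]
  congr 1 <;> ring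

/-- Every elliptic curve over `ℚ` has a short Weierstrass equation `y² = x³ + A x + B` with
integers `A`, `B` such that `gcd (A³, B²)` is not divisible by any twelfth power. -/
theorem exists_isMinimalPair (W : WeierstrassCurve ℚ) (hW : W.IsElliptic) :
    ∃ A B : ℤ, IsMinimalPair A B ∧
      ∃ C : VariableChange ℚ, C • W = shortCurve (A : ℚ) (B : ℚ) := by
  have key : ∀ (N : ℕ) (A B : ℤ), (4 * A ^ 3 + 27 * B ^ 2).natAbs = N →
      (∃ C : VariableChange ℚ, C • W = shortCurve (A : ℚ) (B : ℚ)) →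
      ∃ A B : ℤ, IsMinimalPair A B ∧
        ∃ C : VariableChange ℚ, C • W = shortCurve (A : ℚ) (B : ℚ) := by
    intro N
    induction N using Nat.strong_induction_on with
    | _ N ih =>
      rintro A B rfl ⟨C, hC⟩
      have hD : 4 * A ^ 3 + 27 * B ^ 2 ≠ 0 := by
        rw [← isElliptic_shortCurve_iff, ← hC]
        infer_instance
      by_cases hm : IsMinimalPair A B
      · exact ⟨A, B, hm, C, hC⟩
      have : ∃ n : ℕ, 1 < n ∧ n ^ 12 ∣ Int.gcd (A ^ 3) (B ^ 2) := by
        by_contra! hcon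
        exact hm ⟨hD, hcon⟩
      obtain ⟨n, hn, hdvd⟩ := this
      obtain ⟨⟨a, rfl⟩, ⟨b, rfl⟩⟩ := (pow_dvd_gcd_iff A B n).1 hdvd
      have hn0 : (n : ℚ) ≠ 0 := by positivity
      have hfac : 4 * ((n : ℤ) ^ 4 * a) ^ 3 + 27 * ((n : ℤ) ^ 6 * b) ^ 2 =
          (n : ℤ) ^ 12 * (4 * a ^ 3 + 27 * b ^ 2) := by ring
      rw [hfac] at hD ih
      have hd0 : (4 * a ^ 3 + 27 * b ^ 2).natAbs ≠ 0 := by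
        rw [Int.natAbs_ne_zero]
        exact right_ne_zero_of_mul hD
      refine ih _ ?_ a b rfl ⟨⟨(Units.mk0 (n : ℚ) hn0), 0, 0, 0⟩ * C, ?_⟩
      · rw [Int.natAbs_mul, Int.natAbs_pow, Int.natAbs_natCast]
        exact lt_mul_of_one_lt_left (Nat.pos_of_ne_zero hd0)
          (Nat.one_lt_pow (by norm_num) hn)
      · rw [mul_smul, hC]
        have := scale_shortCurve (Units.mk0 (n : ℚ) hn0)⁻¹
          (((n : ℤ) ^ 4 * a : ℤ) : ℚ) (((n : ℤ) ^ 6 * b : ℤ) : ℚ)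
        rw [inv_inv] at this
        rw [this]
        push_cast
        simp only [Units.val_inv_eq_inv_val, Units.val_mk0]
        congr 1 <;> field_simp
  obtain ⟨A, B, C, hC⟩ := exists_integral_short W
  exact key _ A B rfl ⟨C, hC⟩

/-- The equation of the previous statement is unique. -/
theorem isMinimalPair_unique {A B A' B' : ℤ} (h : IsMinimalPair A B) (h' : IsMinimalPair A' B')
    (hC : ∃ C : VariableChange ℚ, C • shortCurve (A : ℚ) (B : ℚ) = shortCurve (A' : ℚ) (B' : ℚ)) :
    A = A' ∧ B = B' := by
  obtain ⟨C, hC⟩ := hC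
  rw [variableChange_def] at hC
  simp only [shortCurve, WeierstrassCurve.mk.injEq] at hC
  obtain ⟨h1, h2, h3, h4, h6⟩ := hC
  have hs : C.s = 0 := by simpa using h1
  have hr : C.r = 0 := by simpa [hs] using h2
  have ht : C.t = 0 := by simpa [hr] using h3
  simp only [hs, hr, ht] at h4 h6
  set v : ℚ := ((C.u⁻¹ : ℚˣ) : ℚ) with hv
  have hv0 : v ≠ 0 := Units.ne_zero _
  have e4 : v ^ 4 * A = A' := by rw [← h4]; ring
  have e6 : v ^ 6 * B = B' := by rw [← h6]; ring
  have hden : (v.den : ℚ) ≠ 0 := by exact_mod_cast v.den_nz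
  have hvv : v * v.den = v.num := Rat.mul_den_eq_num v
  have f4 : v.num ^ 4 * A = (v.den : ℤ) ^ 4 * A' := by
    have : (v.num : ℚ) ^ 4 * A = (v.den : ℚ) ^ 4 * A' := by rw [← hvv, ← e4]; ring
    exact_mod_cast this
  have f6 : v.num ^ 6 * B = (v.den : ℤ) ^ 6 * B' := by
    have : (v.num : ℚ) ^ 6 * B = (v.den : ℚ) ^ 6 * B' := by rw [← hvv, ← e6]; ring
    exact_mod_cast this
  have hco : IsCoprime v.num (v.den : ℤ) := by
    rw [Int.isCoprime_iff_gcd_eq_one, Int.gcd, Int.natAbs_natCast]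
    exact v.reduced
  have hden1 : v.den = 1 := by
    by_contra hne
    have hpos := v.den_pos
    refine h.2 v.den (by omega) ((pow_dvd_gcd_iff _ _ _).2 ⟨?_, ?_⟩)
    · exact hco.symm.pow.dvd_of_dvd_mul_left (Dvd.intro _ f4.symm)
    · exact hco.symm.pow.dvd_of_dvd_mul_left (Dvd.intro _ f6.symm)
  have hnum1 : v.num.natAbs = 1 := by
    by_contra hne
    have hpos : v.num.natAbs ≠ 0 := by
      simpa using hv0
    refine h'.2 v.num.natAbs (by omega) ((pow_dvd_gcd_iff _ _ _).2 ⟨?_, ?_⟩)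
    · rw [Int.natCast_natAbs, Even.pow_abs (by decide)]
      exact hco.pow.dvd_of_dvd_mul_left (Dvd.intro _ f4)
    · rw [Int.natCast_natAbs, Even.pow_abs (by decide)]
      exact hco.pow.dvd_of_dvd_mul_left (Dvd.intro _ f6)
  have hsq : v.num ^ 2 = 1 := by
    rw [← Int.natAbs_sq, hnum1]; norm_num
  have g4 : v.num ^ 4 = 1 := by rw [show v.num ^ 4 = (v.num ^ 2) ^ 2 by ring, hsq]; norm_num
  have g6 : v.num ^ 6 = 1 := by rw [show v.num ^ 6 = (v.num ^ 2) ^ 3 by ring, hsq]; norm_num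
  rw [g4, hden1] at f4
  rw [g6, hden1] at f6
  constructor
  · simpa using f4
  · simpa using f6

/-- Elliptic curves over `ℚ`, given by Weierstrass equations, up to isomorphism over `ℚ`
(change of Weierstrass coordinates). -/
def curveSetoid : Setoid {W : WeierstrassCurve ℚ // W.IsElliptic} where
  r W W' := ∃ C : VariableChange ℚ, C • W.1 = W'.1
  iseqv :=
    { refl := fun W => ⟨1, one_smul _ _⟩
      symm := by
        rintro W W' ⟨C, hC⟩
        exact ⟨C⁻¹, by rw [← hC, inv_smul_smul]⟩
      trans := by
        rintro W W' W'' ⟨C, hC⟩ ⟨C', hC'⟩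
        exact ⟨C' * C, by rw [mul_smul, hC, hC']⟩ }

/-- The set of isomorphism classes of elliptic curves over `ℚ`. -/
def CurveClass : Type := Quotient curveSetoid

/-- The isomorphism class of an elliptic curve over `ℚ`. -/
def classOf (W : WeierstrassCurve ℚ) (hW : W.IsElliptic) : CurveClass :=
  Quotient.mk curveSetoid ⟨W, hW⟩

theorem CurveClass.exists_pair (c : CurveClass) : ∃ AB : ℤ × ℤ, ∃ h : IsMinimalPair AB.1 AB.2,
    c = classOf (shortCurve (AB.1 : ℚ) (AB.2 : ℚ)) ((isElliptic_shortCurve_iff _ _).2 h.1) := by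
  induction c using Quotient.inductionOn with
  | _ W =>
    obtain ⟨A, B, h, hC⟩ := exists_isMinimalPair W.1 W.2
    exact ⟨(A, B), h, Quotient.sound hC⟩

/-- The coefficient `A` of the unique equation `y² = x³ + A x + B` of the class. -/
def CurveClass.A (c : CurveClass) : ℤ := c.exists_pair.choose.1

/-- The coefficient `B` of the unique equation `y² = x³ + A x + B` of the class. -/
def CurveClass.B (c : CurveClass) : ℤ := c.exists_pair.choose.2

/-- The curve `y² = x³ + A x + B` over `ℚ` representing the class. -/
def CurveClass.curve (c : CurveClass) : WeierstrassCurve ℚ := shortCurve (c.A : ℚ) (c.B : ℚ)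

theorem CurveClass.isMinimalPair (c : CurveClass) : IsMinimalPair c.A c.B :=
  c.exists_pair.choose_spec.choose

theorem CurveClass.isElliptic (c : CurveClass) : c.curve.IsElliptic :=
  (isElliptic_shortCurve_iff _ _).2 c.isMinimalPair.1

theorem CurveClass.classOf_curve (c : CurveClass) : classOf c.curve c.isElliptic = c :=
  c.exists_pair.choose_spec.choose_spec.symm

/-- `A` and `B` do not depend on choices. -/
theorem CurveClass.eq_of_isMinimalPair {A B : ℤ} (h : IsMinimalPair A B) :
    (classOf (shortCurve (A : ℚ) (B : ℚ)) ((isElliptic_shortCurve_iff _ _).2 h.1)).A = A ∧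
    (classOf (shortCurve (A : ℚ) (B : ℚ)) ((isElliptic_shortCurve_iff _ _).2 h.1)).B = B := by
  set c := classOf (shortCurve (A : ℚ) (B : ℚ)) ((isElliptic_shortCurve_iff _ _).2 h.1) with hc
  exact isMinimalPair_unique c.isMinimalPair h
    (Quotient.exact (c.classOf_curve.trans hc))

/-- The height `max (|A|³, |B|²)`. -/
def CurveClass.height (c : CurveClass) : ℤ := max (|c.A| ^ 3) (|c.B| ^ 2)

/-- The isomorphism classes of elliptic curves in `S` of height `< X`. -/
def belowHeight (S : Set CurveClass) (X : ℝ) : Set CurveClass := {c ∈ S | (c.height : ℝ) < X}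

/-- The upper density `limsup_{X → ∞} #S(X) / #ℰ(X)` of a set `S` of isomorphism classes of
elliptic curves over `ℚ`, ordered by height. -/
def upperDensity (S : Set CurveClass) : ℝ :=
  limsup (fun X : ℝ =>
    ((belowHeight S X).ncard : ℝ) / ((belowHeight Set.univ X).ncard : ℝ)) atTop

/-- There are only finitely many isomorphism classes of bounded height. -/
theorem finite_belowHeight (S : Set CurveClass) (X : ℝ) : (belowHeight S X).Finite := by
  have hfin : ((Set.Icc (-⌈X⌉) ⌈X⌉) ×ˢ (Set.Icc (-⌈X⌉) ⌈X⌉) : Set (ℤ × ℤ)).Finite :=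
    (Set.finite_Icc _ _).prod (Set.finite_Icc _ _)
  have hbound : ∀ (a : ℤ) (k : ℕ), k ≠ 0 → (((|a| ^ k : ℤ)) : ℝ) < X →
      a ∈ Set.Icc (-⌈X⌉) ⌈X⌉ := by
    intro a k hk h
    have h1 : |a| ≤ |a| ^ k := by
      rcases eq_or_ne a 0 with rfl | ha
      · simp [hk]
      · exact le_self_pow₀ (Int.one_le_abs ha) hk
    have h2 : (|a| ^ k : ℤ) ≤ ⌈X⌉ := by
      exact_mod_cast (h.le.trans (Int.le_ceil X))
    exact abs_le.1 (h1.trans h2)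
  refine Set.Finite.of_finite_image (f := fun c : CurveClass => (c.A, c.B))
    (hfin.subset ?_) ?_
  · rintro _ ⟨c, ⟨-, hc⟩, rfl⟩
    have hA : (((|c.A| ^ 3 : ℤ)) : ℝ) < X :=
      lt_of_le_of_lt (by exact_mod_cast le_max_left _ _) hc
    have hB : (((|c.B| ^ 2 : ℤ)) : ℝ) < X :=
      lt_of_le_of_lt (by exact_mod_cast le_max_right _ _) hc
    exact ⟨hbound _ 3 (by norm_num) hA, hbound _ 2 (by norm_num) hB⟩
  · intro c _ c' _ hcc
    simp only [Prod.mk.injEq] at hcc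
    rw [← c.classOf_curve, ← c'.classOf_curve]
    simp only [CurveClass.curve, hcc.1, hcc.2]

/-! ### Tamagawa numbers -/

section Local

variable (R : Type*) [CommRing R] [IsDomain R] [IsDiscreteValuationRing R]
variable {K : Type*} [Field K] [Algebra R K] [IsFractionRing R K]

/-- A point of a minimal Weierstrass equation over the fraction field `K` of a discrete valuation
ring `R` has nonsingular reduction: it is the point at infinity, or its coordinates are not both
in `R` (then neither is, and the point reduces to the point at infinity, which is nonsingular), or
its coordinates are in `R` and reduce to a nonsingular point of the reduced equation. -/
def HasNonsingularReduction (W : WeierstrassCurve K) [W.IsMinimal R] : W.toAffine.Point → Prop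
  | .zero => True
  | .some x y _ => ∀ x₀ y₀ : R, algebraMap R K x₀ = x → algebraMap R K y₀ = y →
      (W.reduction R).toAffine.Nonsingular (IsLocalRing.residue R x₀) (IsLocalRing.residue R y₀)

open scoped Classical in
/-- The subgroup `E₀(K)` of points with nonsingular reduction (these points form a subgroup, so
it is the subgroup that they generate). -/
def nonsingularReductionSubgroup (W : WeierstrassCurve K) [W.IsMinimal R] :
    AddSubgroup W.toAffine.Point :=
  AddSubgroup.closure {P | HasNonsingularReduction R W P}

open scoped Classical in
/-- The index `[E(K) : E₀(K)]`, computed on a minimal Weierstrass equation of `E`. -/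
def localTamagawaNumber (W : WeierstrassCurve K) : ℕ :=
  (nonsingularReductionSubgroup R (W.minimal R)).index

end Local

/-- The Tamagawa number `c_l(E) = [E(ℚ_l) : E₀(ℚ_l)]` of an elliptic curve `E` over `ℚ`. -/
def tamagawaNumber (l : ℕ) [Fact l.Prime] (W : WeierstrassCurve ℚ) : ℕ :=
  localTamagawaNumber ℤ_[l] (W.baseChange ℚ_[l])

/-- The `p`-part `p ^ v_p (c_l(E))` of the Tamagawa number. -/
def tamagawaPart (p l : ℕ) [Fact l.Prime] (W : WeierstrassCurve ℚ) : ℕ :=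
  p ^ padicValNat p (tamagawaNumber l W)

/-- `τ_p(E)`, the product over all primes `l` of the `p`-parts of the Tamagawa numbers; almost all
factors are `1`, since `c_l(E) = 1` at primes of good reduction. -/
def tau (p : ℕ) (W : WeierstrassCurve ℚ) : ℕ :=
  ∏ᶠ l : Nat.Primes, haveI : Fact (l : ℕ).Prime := ⟨l.2⟩; tamagawaPart p l W

/-! ### Reduction modulo `p` -/

/-- The reduction modulo `p` of the equation `y² = x³ + A x + B` of the class. For `p ≥ 5` this
equation is minimal at `p`. -/
def CurveClass.reductionMod (c : CurveClass) (p : ℕ) : WeierstrassCurve (ZMod p) :=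
  shortCurve (c.A : ZMod p) (c.B : ZMod p)

/-- Good reduction at a prime `p ≥ 5`: the reduced curve is an elliptic curve over `𝔽_p`. -/
def CurveClass.HasGoodReductionAt (c : CurveClass) (p : ℕ) : Prop :=
  (c.reductionMod p).IsElliptic

/-- `δ_p(E)`, the number of `p`-torsion points of the reduced curve over `𝔽_p`. -/
def CurveClass.delta (c : CurveClass) (p : ℕ) [Fact p.Prime] : ℕ :=
  Nat.card {P : (c.reductionMod p).toAffine.Point // p • P = 0}

/-- The classes of elliptic curves `E` for which `p` divides `τ_p(E)`. -/
def tamagawaSet (p : ℕ) : Set CurveClass := {c | p ∣ tau p c.curve}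

/-- The classes of elliptic curves `E` with good reduction at `p` for which `p` divides
`δ_p(E)`. -/
def anomalousSet (p : ℕ) [Fact p.Prime] : Set CurveClass :=
  {c | c.HasGoodReductionAt p ∧ p ∣ c.delta p}

/-- `d(p)`, the number of pairs `(a, b)` in `𝔽_p × 𝔽_p` with `4a³ + 27b² ≠ 0` for which
`y² = x³ + a x + b` has a point of order `p` over `𝔽_p`. -/
def dCount (p : ℕ) [Fact p.Prime] : ℕ :=
  {κ : ZMod p × ZMod p | 4 * κ.1 ^ 3 + 27 * κ.2 ^ 2 ≠ 0 ∧
    ∃ P : (shortCurve κ.1 κ.2).toAffine.Point, addOrderOf P = p}.ncard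

end EllipticDensity

end

open Filter

noncomputable section

namespace EllipticDensity

/-! ### Points with singular reduction on a minimal Weierstrass equation. -/

section Reduction

open WeierstrassCurve IsLocalRing

variable {R : Type*} [CommRing R]

/-! Write a = X^(1/3) and b = X^(1/2). Möbius inversion over the weighted divisors n (n⁴ ∣ A, n⁶ ∣
B), with dominated convergence in n, gives asymptotically at least 4ab/ζ(10) curves of height below
X. A set of curves with at most 4c·ab members asymptotically thus has upper density at most ζ(10)·c
(`upperDensity_le`). For the third set, (A, B) lies in one of d(p) residue classes modulo p, each
holding about 4ab/p² pairs.

For the Tamagawa set the local input is elementary and uses neither Tate curves nor Néron models. If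
p ∣ c_l, Cauchy's theorem gives P of order p in the component quotient, so kP reduces to the
singular point for 0 < k < p. Lines through such points have integral slope and reduce to tangents
at the singular point (`SingularReduction.exists_slope`). At a cusp this would make the equation
non-minimal (`exists_node_tangent`), so the singularity is a node. There the valuations of ψ = 2y +
a₁x + a₃ at kP, for 1 ≤ k ≤ (p-1)/2, are positive and pairwise distinct, so one of them is at least
(p-1)/2; since ψ² divides Δ at a point with integral tangent slope, v(Δ) ≥ p-1
(`dvd_Δ_of_multiples`).

Consequently A determines B up to sign modulo q_l = l^(p-1), or l^(p+5) for l = 2, 3. The pairs at l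
have density at most 2/q_l, and only primes l = O(X^(1/4)) occur, so the rounding errors are
negligible. Numerically ζ(10)·Σ 2/q_l ≤ 1.083·0.9·2^(-(p+2)), which is already below the l = 2 term
of the asserted sum. -/

/-- An integral point `(x, y)` of `V` reduces to a singular point modulo `π`. -/
structure SingularMod (V : WeierstrassCurve R) (π x y : R) : Prop where
  equation : y ^ 2 + V.a₁ * x * y + V.a₃ * y = x ^ 3 + V.a₂ * x ^ 2 + V.a₄ * x + V.a₆
  dvd_Y : π ∣ 2 * y + V.a₁ * x + V.a₃
  dvd_X : π ∣ V.a₁ * y - (3 * x ^ 2 + 2 * V.a₂ * x + V.a₄)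

theorem SingularMod.neg {V : WeierstrassCurve R} {π x y : R} (h : SingularMod V π x y) :
    SingularMod V π x (-y - V.a₁ * x - V.a₃) where
  equation := by linear_combination h.equation
  dvd_Y := by
    have := h.dvd_Y.neg_right
    ring_nf at this ⊢
    exact this
  dvd_X := by
    have := h.dvd_X.sub (h.dvd_Y.mul_left V.a₁)
    ring_nf at this ⊢
    exact this

/-- A Weierstrass equation has at most one singular point. -/
theorem SingularMod.congr {V : WeierstrassCurve R} {π x y x' y' : R} (hπ : Prime π)
    (h : SingularMod V π x y) (h' : SingularMod V π x' y') : π ∣ x - x' ∧ π ∣ y - y' := by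
  obtain ⟨u, hu⟩ := h.dvd_Y
  obtain ⟨v, hv⟩ := h.dvd_X
  obtain ⟨u', hu'⟩ := h'.dvd_Y
  obtain ⟨v', hv'⟩ := h'.dvd_X
  have e := h.equation
  have e' := h'.equation
  have hx : π ∣ x - x' := by
    -- The trapezoid rule is exact up to the cubic term: twice the difference of the two equations,
    -- minus the increments paired with the sum of both gradients, leaves only (x - x')³. No
    -- division by 2 or 3 occurs, so every residue characteristic is covered.
    refine hπ.dvd_of_dvd_pow (n := 3) ⟨-((y - y') * (u + u') + (x - x') * (v + v')), ?_⟩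
    linear_combination 2 * e - 2 * e' - (y - y') * hu - (y - y') * hu' -
      (x - x') * hv - (x - x') * hv'
  refine ⟨hx, hπ.dvd_of_dvd_pow (n := 2) ?_⟩
  obtain ⟨w, hw⟩ := hx
  refine ⟨(y - y') * u + w * (V.a₁ * y' - (x' ^ 2 + x * x' + x ^ 2 + V.a₂ * (x + x') + V.a₄)), ?_⟩
  linear_combination e' - e + (y - y') * hu +
    (V.a₁ * y' - (x' ^ 2 + x * x' + x ^ 2 + V.a₂ * (x + x') + V.a₄)) * hw

/-- The discriminant is divisible by the square of `2y + a₁x + a₃` if the tangent at `(x, y)` has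
integral slope `l`. -/
theorem sq_dvd_Δ_of_slope (V : WeierstrassCurve R) {x y l : R}
    (e : y ^ 2 + V.a₁ * x * y + V.a₃ * y = x ^ 3 + V.a₂ * x ^ 2 + V.a₄ * x + V.a₆)
    (hl : (2 * y + V.a₁ * x + V.a₃) * l = 3 * x ^ 2 + 2 * V.a₂ * x + V.a₄ - V.a₁ * y) :
    (2 * y + V.a₁ * x + V.a₃) ^ 2 ∣ V.Δ := by
  -- Moving the point to the origin and its tangent to y = 0 kills a₄ and a₆ and turns a₃ into 2y +
  -- a₁x + a₃; every remaining term of Δ contains a₃².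
  have hΔ := V.variableChange_Δ ⟨1, x, l, y⟩
  have h4 : ((⟨1, x, l, y⟩ : VariableChange R) • V).a₄ = 0 := by
    simp only [variableChange_a₄, inv_one, Units.val_one]
    linear_combination -hl
  have h6 : ((⟨1, x, l, y⟩ : VariableChange R) • V).a₆ = 0 := by
    simp only [variableChange_a₆, inv_one, Units.val_one]
    linear_combination -e
  have h3 : ((⟨1, x, l, y⟩ : VariableChange R) • V).a₃ = 2 * y + V.a₁ * x + V.a₃ := by
    simp only [variableChange_a₃, inv_one, Units.val_one]
    ring
  simp only [inv_one, Units.val_one, one_pow, one_mul] at hΔ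
  rw [← hΔ, ← h3]
  generalize (⟨1, x, l, y⟩ : VariableChange R) • V = U at h4 h6
  rw [WeierstrassCurve.Δ, b₈, b₆, b₄, b₂, h4, h6]
  exact Dvd.intro (-(U.a₁ ^ 2 + 4 * U.a₂) ^ 2 * U.a₂ - 8 * U.a₁ ^ 3 * U.a₃ - 27 * U.a₃ ^ 2 +
    9 * (U.a₁ ^ 2 + 4 * U.a₂) * U.a₁ * U.a₃) (by ring)

variable [IsDomain R] [IsDiscreteValuationRing R]
variable {K : Type*} [Field K] [Algebra R K] [IsFractionRing R K]

variable (R) in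
/-- A point of a minimal equation that reduces to a singular point. -/
def SingularReduction (π : R) (W : WeierstrassCurve K) [W.IsMinimal R] (P : W.toAffine.Point)
    (x y : R) : Prop :=
  SingularMod (W.integralModel R) π x y ∧
    ∃ h : W.toAffine.Nonsingular (algebraMap R K x) (algebraMap R K y), P = .some _ _ h

/-- Nonsingular reduction is vacuous for non-integral coordinates, so its failure supplies
coordinates in `R`. The reduced point still satisfies the equation, hence both partial derivatives
must vanish modulo π. -/
theorem exists_singularReduction {π : R} (hπ : Irreducible π) {W : WeierstrassCurve K}
    [W.IsMinimal R] {P : W.toAffine.Point} (hP : ¬ HasNonsingularReduction R W P) :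
    ∃ x y, SingularReduction R π W P x y := by
  match P, hP with
  | .zero, hP => exact absurd trivial hP
  | .some x y h, hP =>
    simp only [HasNonsingularReduction, not_forall] at hP
    obtain ⟨x₀, y₀, rfl, rfl, hs⟩ := hP
    have heq : y₀ ^ 2 + (W.integralModel R).a₁ * x₀ * y₀ + (W.integralModel R).a₃ * y₀ =
        x₀ ^ 3 + (W.integralModel R).a₂ * x₀ ^ 2 + (W.integralModel R).a₄ * x₀ +
          (W.integralModel R).a₆ := by
      apply IsFractionRing.injective R K
      have := (W.toAffine.equation_iff _ _).1 h.1
      rw [← integralModel_a₁_eq R W, ← integralModel_a₂_eq R W, ← integralModel_a₃_eq R W,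
        ← integralModel_a₄_eq R W, ← integralModel_a₆_eq R W] at this
      simpa only [map_add, map_mul, map_pow] using this
    have hdvd : ∀ z : R, π ∣ z ↔ residue R z = 0 := fun z => by
      rw [residue_eq_zero_iff, hπ.maximalIdeal_eq, Ideal.mem_span_singleton]
    have heq' := congrArg (residue R) heq
    rw [Affine.nonsingular_iff', not_and] at hs
    have hs' := hs (by
      rw [Affine.equation_iff]
      simpa only [reduction, map_a₁, map_a₂, map_a₃, map_a₄, map_a₆, map_add, map_mul, map_pow]
        using heq')
    rw [not_or, not_not, not_not] at hs'
    refine ⟨x₀, y₀, ⟨heq, ?_, ?_⟩, h, rfl⟩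
    · rw [hdvd]
      simpa [reduction, map_ofNat (residue R)] using hs'.2
    · rw [hdvd]
      simpa [reduction, map_ofNat (residue R)] using hs'.1

theorem SingularReduction.neg {π : R} {W : WeierstrassCurve K}
    [W.IsMinimal R] {P : W.toAffine.Point} {x y : R} (h : SingularReduction R π W P x y) :
    SingularReduction R π W (-P) x
      (-y - (W.integralModel R).a₁ * x - (W.integralModel R).a₃) := by
  obtain ⟨h, hP, rfl⟩ := h
  have e : algebraMap R K (-y - (W.integralModel R).a₁ * x - (W.integralModel R).a₃) =
      W.toAffine.negY (algebraMap R K x) (algebraMap R K y) := by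
    simp [Affine.negY, integralModel_a₁_eq, integralModel_a₃_eq]
  refine ⟨h.neg, ?_, ?_⟩
  · rw [e]
    exact (Affine.nonsingular_neg _ _).2 hP
  · simp only [e, Affine.Point.neg_some]

/-! ### Slopes of lines through points with singular reduction. -/

open scoped Classical in
/-- If `P`, `Q` and `P + Q` reduce to the singular point, then the line through `P` and `Q` has
integral slope, and it is tangent to a branch of the reduced curve at the singular point. -/
theorem SingularReduction.exists_slope {π : R} (hπ : Irreducible π) {W : WeierstrassCurve K}
    [W.IsMinimal R] {P Q : W.toAffine.Point} {x₁ y₁ x₂ y₂ x₃ y₃ : R}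
    (h₁ : SingularReduction R π W P x₁ y₁) (h₂ : SingularReduction R π W Q x₂ y₂)
    (h₃ : SingularReduction R π W (P + Q) x₃ y₃) :
    ∃ l : R, (x₁ - x₂) * l = y₁ - y₂ ∧
      (P = Q → (2 * y₁ + (W.integralModel R).a₁ * x₁ + (W.integralModel R).a₃) * l =
        3 * x₁ ^ 2 + 2 * (W.integralModel R).a₂ * x₁ + (W.integralModel R).a₄ -
          (W.integralModel R).a₁ * y₁) ∧
      (P ≠ Q → x₁ ≠ x₂) ∧
      x₃ = l ^ 2 + (W.integralModel R).a₁ * l - (W.integralModel R).a₂ - x₁ - x₂ ∧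
      y₃ = -(l * (x₃ - x₁) + y₁) - (W.integralModel R).a₁ * x₃ - (W.integralModel R).a₃ ∧
      π ∣ l ^ 2 + (W.integralModel R).a₁ * l - (W.integralModel R).a₂ - 3 * x₁ := by
  obtain ⟨s₁, n₁, rfl⟩ := h₁
  obtain ⟨s₂, n₂, rfl⟩ := h₂
  obtain ⟨s₃, n₃, h⟩ := h₃
  have hinj := IsFractionRing.injective R K
  by_cases hxy : algebraMap R K x₁ = algebraMap R K x₂ ∧
      algebraMap R K y₁ = W.toAffine.negY (algebraMap R K x₂) (algebraMap R K y₂)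
  · rw [Affine.Point.add_of_Y_eq hxy.1 hxy.2] at h
    exact absurd h.symm (Affine.Point.some_ne_zero _)
  rw [Affine.Point.add_some hxy, Affine.Point.some.injEq] at h
  obtain ⟨hx, hy⟩ := h
  set L := W.toAffine.slope (algebraMap R K x₁) (algebraMap R K x₂) (algebraMap R K y₁)
    (algebraMap R K y₂) with hL
  rw [Affine.addY, Affine.negAddY, Affine.negY, hx] at hy
  rw [Affine.addX] at hx
  -- The addition formula for x(P + Q) is a monic quadratic equation for the slope, with
  -- coefficients in `R` because all three abscissas are integral.
  have hint : _root_.IsIntegral R L := by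
    refine ⟨Polynomial.X ^ 2 + (Polynomial.C (W.integralModel R).a₁ * Polynomial.X +
      Polynomial.C (-((W.integralModel R).a₂ + x₁ + x₂ + x₃))), ?_, ?_⟩
    · exact Polynomial.monic_X_pow_add (Polynomial.degree_linear_lt)
    · simp only [Polynomial.eval₂_add, Polynomial.eval₂_mul, Polynomial.eval₂_pow,
        Polynomial.eval₂_X, Polynomial.eval₂_C]
      simp only [map_add, map_neg, integralModel_a₁_eq,
        integralModel_a₂_eq]
      linear_combination hx
  obtain ⟨l, hl⟩ := IsIntegrallyClosed.isIntegral_iff.1 hint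
  rw [← hl] at hx hy
  have ex : x₃ = l ^ 2 + (W.integralModel R).a₁ * l - (W.integralModel R).a₂ - x₁ - x₂ := by
    apply hinj
    simp only [map_sub, map_add, map_mul, map_pow, integralModel_a₁_eq, integralModel_a₂_eq]
    exact hx.symm
  refine ⟨l, ?_, ?_, ?_, ex, ?_, ?_⟩
  · apply hinj
    simp only [map_sub, map_mul, hl]
    by_cases hx12 : algebraMap R K x₁ = algebraMap R K x₂
    · have := Affine.Y_eq_of_Y_ne n₁.1 n₂.1 hx12 (fun h => hxy ⟨hx12, h⟩)
      rw [hx12, this]; ring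
    · rw [hL, Affine.slope_of_X_ne hx12]
      field_simp [sub_ne_zero.2 hx12]
  · intro hPQ
    rw [Affine.Point.some.injEq] at hPQ
    obtain ⟨hx12, hy12⟩ := hPQ
    have hne : algebraMap R K y₁ ≠ W.toAffine.negY (algebraMap R K x₂) (algebraMap R K y₂) :=
      fun h => hxy ⟨hx12, h⟩
    have hs := Affine.slope_of_Y_ne hx12 hne
    rw [← hL, ← hl] at hs
    rw [← hx12, ← hy12] at hne
    rw [eq_div_iff (sub_ne_zero.2 hne), Affine.negY] at hs
    apply hinj
    simp only [map_sub, map_add, map_mul, map_pow, integralModel_a₁_eq, integralModel_a₂_eq,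
      integralModel_a₃_eq, integralModel_a₄_eq, map_ofNat]
    linear_combination hs
  · intro hPQ hx12
    apply hPQ
    subst hx12
    have := Affine.Y_eq_of_Y_ne n₁.1 n₂.1 rfl (fun h => hxy ⟨rfl, h⟩)
    simp only [this]
  · apply hinj
    simp only [map_sub, map_add, map_mul, map_neg, integralModel_a₁_eq, integralModel_a₃_eq]
    exact hy.symm
  -- All three points reduce to the same singular point, so x₂ and x₃ may be replaced by x₁ modulo π
  -- in the addition formula.
  · have h31 := (s₃.congr hπ.prime s₁).1
    have h21 := (s₂.congr hπ.prime s₁).1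
    have := h31.add h21
    rw [ex] at this
    ring_nf at this ⊢
    exact this

/-- An integral equation all of whose coefficients `aᵢ` are divisible by `πⁱ` is not minimal. -/
theorem not_isMinimal_of_dvd {π : R} (hπ : Irreducible π) (W : WeierstrassCurve K) [W.IsMinimal R]
    (hΔ : W.Δ ≠ 0) (x l y : R) {V : WeierstrassCurve R}
    (hV : V = (⟨1, x, l, y⟩ : VariableChange R) • W.integralModel R)
    (h₁ : π ∣ V.a₁) (h₂ : π ^ 2 ∣ V.a₂) (h₃ : π ^ 3 ∣ V.a₃) (h₄ : π ^ 4 ∣ V.a₄)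
    (h₆ : π ^ 6 ∣ V.a₆) : False := by
  have hπ0 : algebraMap R K π ≠ 0 := by
    rw [Ne, IsFractionRing.to_map_eq_zero_iff]; exact hπ.ne_zero
  obtain ⟨b₁, h₁⟩ := h₁
  obtain ⟨b₂, h₂⟩ := h₂
  obtain ⟨b₃, h₃⟩ := h₃
  obtain ⟨b₄, h₄⟩ := h₄
  obtain ⟨b₆, h₆⟩ := h₆
  -- Rescaling by u = π divides each aᵢ by πⁱ and Δ by π¹². The new equation is still integral and
  -- its discriminant is strictly larger for the multiplicative valuation, against minimality.
  let C : VariableChange K := (⟨Units.mk0 _ hπ0, 0, 0, 0⟩ : VariableChange K) *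
    (⟨1, x, l, y⟩ : VariableChange R).map (algebraMap R K)
  have hC : C • W = (⟨Units.mk0 _ hπ0, 0, 0, 0⟩ : VariableChange K) • V.map (algebraMap R K) := by
    rw [mul_smul, hV, ← map_variableChange]
    congr 2
    exact (baseChange_integralModel_eq R W).symm
  have hint : WeierstrassCurve.IsIntegral R (C • W) := by
    rw [hC]
    refine ⟨⟨b₁, b₂, b₃, b₄, b₆⟩, ?_⟩
    ext <;> simp [variableChange_def, h₁, h₂, h₃, h₄, h₆, baseChange, hπ0]
  have hmax := (IsMinimal.val_Δ_maximal (R := R) (W := W)).2 hint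
  have hone : WeierstrassCurve.IsIntegral R ((1 : VariableChange K) • W) := by
    rw [one_smul]; infer_instance
  have hu : (C.u : K) = algebraMap R K π := by simp [C, VariableChange.mul_def, VariableChange.map]
  have hΔ' : W.Δ = algebraMap R K π ^ 12 * (C • W).Δ := by
    rw [variableChange_Δ, Units.val_inv_eq_inv_val, hu]
    field_simp
  set v := IsDedekindDomain.HeightOneSpectrum.valuation K
    (IsDiscreteValuationRing.maximalIdeal R) with hv
  have hvπ : v (algebraMap R K π) ^ 12 < 1 := by
    refine pow_lt_one₀ zero_le ?_ (by norm_num)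
    rw [hv, IsDedekindDomain.HeightOneSpectrum.valuation_lt_one_iff_mem]
    exact hπ.not_isUnit
  have hlt : v W.Δ < v (C • W).Δ := by
    have hne : v (C • W).Δ ≠ 0 := by
      rw [Valuation.ne_zero_iff]
      rintro h
      exact hΔ (by rw [hΔ', h, mul_zero])
    rw [hΔ', map_mul, map_pow]
    exact mul_lt_of_lt_one_left (zero_lt_iff.2 hne) hvπ
  have h1 : (valuation_Δ_aux R ((1 : VariableChange K) • W)).1 = v W.Δ := by
    rw [valuation_Δ_aux_eq_of_isIntegral, one_smul]
  have h2 : (valuation_Δ_aux R (C • W)).1 = v (C • W).Δ := valuation_Δ_aux_eq_of_isIntegral R _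
  have := hmax (Subtype.coe_le_coe.1 (by rw [h1, h2]; exact hlt.le))
  rw [← Subtype.coe_le_coe, h1, h2] at this
  exact absurd this (not_le.2 hlt)

open scoped Classical in
/-- If `P`, `2P`, `3P`, `4P` reduce to the singular point, then this point is a node, and the
tangent at `P` reduces to a tangent of one of its branches. -/
theorem exists_node_tangent {π : R} (hπ : Irreducible π) {W : WeierstrassCurve K}
    [W.IsMinimal R] (hΔ : W.Δ ≠ 0) {P : W.toAffine.Point} {x₁ y₁ x₂ y₂ x₃ y₃ x₄ y₄ : R}
    (h₁ : SingularReduction R π W P x₁ y₁)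
    (h₂ : SingularReduction R π W (P + P) x₂ y₂)
    (h₃ : SingularReduction R π W (P + (P + P)) x₃ y₃)
    (h₄ : SingularReduction R π W ((P + P) + (P + P)) x₄ y₄) :
    ∃ l : R, π ∣ l ^ 2 + (W.integralModel R).a₁ * l - (W.integralModel R).a₂ - 3 * x₁ ∧
      ¬ π ∣ (W.integralModel R).a₁ + 2 * l ∧ ¬ π ∣ (W.integralModel R).c₄ := by
  obtain ⟨l, -, hl, -, hx₂, hy₂, htl⟩ := h₁.exists_slope hπ h₁ h₂
  obtain ⟨m, hm, -, -, -, -, htm⟩ := h₁.exists_slope hπ h₂ h₃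
  obtain ⟨n, -, hn, -, -, -, htn⟩ := h₂.exists_slope hπ h₂ h₄
  replace hl := hl rfl
  replace hn := hn rfl
  have hπp := hπ.prime
  have hx21 := (h₂.1.congr hπp h₁.1).1
  have he := h₁.1.equation
  have hψ := h₁.1.dvd_Y
  -- In `V` the point P is the origin with tangent y = 0, so a₄ = a₆ = 0, while a₂ = x(P) - x(2P)
  -- and a₃ = ψ(P).
  obtain ⟨V, hV⟩ : ∃ V, V = (⟨1, x₁, l, y₁⟩ : VariableChange R) • W.integralModel R := ⟨_, rfl⟩
  have hc₄ : V.c₄ = (W.integralModel R).c₄ := by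
    rw [hV, variableChange_c₄]; simp
  have e₁ : V.a₁ = (W.integralModel R).a₁ + 2 * l := by
    rw [hV]; simp [variableChange_a₁]
  have e₂ : V.a₂ = x₁ - x₂ := by
    rw [hV, hx₂]; simp only [variableChange_a₂, inv_one, Units.val_one]; ring
  have e₃ : V.a₃ = 2 * y₁ + (W.integralModel R).a₁ * x₁ + (W.integralModel R).a₃ := by
    rw [hV]; simp only [variableChange_a₃, inv_one, Units.val_one]; ring
  have e₄ : V.a₄ = 0 := by
    rw [hV]; simp only [variableChange_a₄, inv_one, Units.val_one]; linear_combination -hl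
  have e₆ : V.a₆ = 0 := by
    rw [hV]; simp only [variableChange_a₆, inv_one, Units.val_one]; linear_combination -he
  have d₂ : π ∣ V.a₂ := by rw [e₂, ← neg_sub]; exact hx21.neg_right
  have d₃ : π ∣ V.a₃ := by rw [e₃]; exact hψ
  have key : ¬ π ∣ V.a₁ := by
    intro d₁
    -- With π ∣ a₁ + 2l the tangent quadratic has a double root modulo π, so the slopes m (through P
    -- and 2P) and n (tangent at 2P) are both congruent to l.
    have tangent : ∀ t x : R, π ∣ x - x₁ → π ∣ t ^ 2 + (W.integralModel R).a₁ * t -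
        (W.integralModel R).a₂ - 3 * x → π ∣ t - l := by
      intro t x hx ht
      refine hπp.dvd_of_dvd_pow (n := 2) ?_
      have h := ((ht.sub htl).sub (d₁.mul_left (t - l))).add (hx.mul_left 3)
      rw [e₁] at h
      convert h using 1
      ring
    have dm := tangent m x₁ (by simp) htm
    have dn := tangent n x₂ hx21 htn
    -- `f₃` expresses that the chord from P to 2P has slope m, and `f₂` that the tangent at 2P has
    -- slope n. They give π² ∣ a₂ and then π³ ∣ a₃, which contradicts minimality.
    have f₃ : V.a₃ = (m - l + V.a₁) * V.a₂ := by
      rw [e₁, e₂, e₃]; linear_combination -hm + hy₂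
    have f₂ : V.a₂ * (V.a₂ + (m - l) * (n - l + V.a₁)) = 0 := by
      have hx₂' : x₂ = x₁ - V.a₂ := by rw [e₂]; ring
      have hy₂' : y₂ = y₁ - m * V.a₂ := by rw [e₂]; linear_combination hm
      have ha₂ : (W.integralModel R).a₂ = V.a₂ + l ^ 2 + (W.integralModel R).a₁ * l - 3 * x₁ := by
        rw [e₂]; linear_combination hx₂
      rw [hx₂', hy₂'] at hn
      rw [e₁, e₃] at f₃
      rw [e₁]
      linear_combination -hn + hl + (n - l) * f₃ + 2 * V.a₂ * ha₂
    have g₂ : π ^ 2 ∣ V.a₂ := by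
      rcases mul_eq_zero.1 f₂ with h | h
      · rw [h]; exact dvd_zero _
      · rw [eq_neg_of_add_eq_zero_left h, dvd_neg, pow_two]
        exact mul_dvd_mul dm (dn.add d₁)
    refine not_isMinimal_of_dvd hπ W hΔ x₁ l y₁ hV d₁ g₂ ?_ (e₄ ▸ dvd_zero _) (e₆ ▸ dvd_zero _)
    rw [f₃, pow_succ']
    exact mul_dvd_mul (dm.add d₁) g₂
  refine ⟨l, htl, e₁ ▸ key, fun h => key ?_⟩
  -- Since π divides a₂ and a₃ and a₄ = 0, c₄ is congruent to a₁⁴ modulo π.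
  rw [← hc₄, c₄, b₂, b₄, e₄] at h
  refine hπp.dvd_of_dvd_pow (n := 4) ?_
  have := (h.sub (d₂.mul_left (8 * V.a₁ ^ 2 + 16 * V.a₂))).add (d₃.mul_left (24 * V.a₁))
  convert this using 1
  ring

open scoped Classical in
/-- Points `P`, `Q` that reduce to a node, with `P + Q` and `P - Q` reducing to the node as well,
are distinguished by the valuation of `2y + a₁x + a₃`. -/
theorem multiplicity_ne_of_singularReduction {π : R} (hπ : Irreducible π) {W : WeierstrassCurve K}
    [W.IsMinimal R] {P Q : W.toAffine.Point} {x₁ y₁ x₂ y₂ x₃ y₃ x₄ y₄ l : R}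
    (h₁ : SingularReduction R π W P x₁ y₁)
    (h₂ : SingularReduction R π W Q x₂ y₂)
    (h₃ : SingularReduction R π W (P + Q) x₃ y₃)
    (h₄ : SingularReduction R π W (P + -Q) x₄ y₄)
    (hl : π ∣ l ^ 2 + (W.integralModel R).a₁ * l - (W.integralModel R).a₂ - 3 * x₁)
    (hnode : ¬ π ∣ (W.integralModel R).a₁ + 2 * l) (hPQ : P ≠ Q) :
    emultiplicity π (2 * y₁ + (W.integralModel R).a₁ * x₁ + (W.integralModel R).a₃) ≠
      emultiplicity π (2 * y₂ + (W.integralModel R).a₁ * x₂ + (W.integralModel R).a₃) := by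
  have hπp := hπ.prime
  obtain ⟨s, hs, -, hx, -, -, hts⟩ := h₁.exists_slope hπ h₂ h₃
  obtain ⟨t, ht, -, -, -, -, htt⟩ := h₁.exists_slope hπ h₂.neg h₄
  replace hx := sub_ne_zero.2 (hx hPQ)
  set a := (W.integralModel R).a₁ with ha
  have tangent : ∀ r : R, π ∣ r ^ 2 + a * r - (W.integralModel R).a₂ - 3 * x₁ →
      π ∣ r - l ∨ π ∣ r + l + a := by
    intro r hr
    refine hπp.dvd_or_dvd ?_
    convert hr.sub hl using 1
    ring
  -- With s and t the slopes of the lines joining P to Q and to -Q, both values of ψ acquire the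
  -- common factor x₁ - x₂.
  have f₁ : 2 * y₁ + a * x₁ + (W.integralModel R).a₃ = (x₁ - x₂) * (s + t + a) := by
    linear_combination -hs - ht
  have f₂ : 2 * y₂ + a * x₂ + (W.integralModel R).a₃ = (x₁ - x₂) * (t - s) := by
    linear_combination hs - ht
  -- Each of s, t is congruent to l or to -l - a, the two distinct tangent slopes at the node. Equal
  -- branches make t - s divisible by π, different branches make s + t + a divisible, never both.
  have key : (π ∣ s + t + a ∧ ¬ π ∣ t - s) ∨ (¬ π ∣ s + t + a ∧ π ∣ t - s) := by
    rcases tangent s hts with h | h <;> rcases tangent t htt with h' | h'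
    · refine Or.inr ⟨fun h'' => hnode ?_, ?_⟩
      · convert (h''.sub h).sub h' using 1; ring
      · convert h'.sub h using 1; ring
    · refine Or.inl ⟨?_, fun h'' => hnode ?_⟩
      · convert h'.add h using 1; ring
      · convert (h'.sub h'').sub h using 1; ring
    · refine Or.inl ⟨?_, fun h'' => hnode ?_⟩
      · convert h'.add h using 1; ring
      · convert (h.add h'').sub h' using 1; ring
    · refine Or.inr ⟨fun h'' => hnode ?_, ?_⟩
      · convert (h.add h').sub h'' using 1; ring
      · convert h'.sub h using 1; ring
  have hfin : FiniteMultiplicity π (x₁ - x₂) := FiniteMultiplicity.of_prime_left hπp hx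
  rw [f₁, f₂, emultiplicity_mul hπp, emultiplicity_mul hπp]
  intro h
  have h' := ENat.add_right_injective_of_ne_top
    (finiteMultiplicity_iff_emultiplicity_ne_top.1 hfin) h
  rcases key with ⟨h1, h2⟩ | ⟨h1, h2⟩
  · rw [emultiplicity_eq_zero.2 h2, emultiplicity_eq_zero] at h'
    exact h' h1
  · rw [emultiplicity_eq_zero.2 h1, eq_comm, emultiplicity_eq_zero] at h'
    exact h' h2

open scoped Classical in
/-- If no multiple `kP` with `0 < k < 2m + 1` has nonsingular reduction, where `m ≥ 2`, then the
reduction is multiplicative and the discriminant has valuation at least `2m`. -/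
theorem dvd_Δ_of_multiples {π : R} (hπ : Irreducible π) {W : WeierstrassCurve K}
    [W.IsMinimal R] (hΔ : W.Δ ≠ 0) {P : W.toAffine.Point} {m : ℕ} (hm : 2 ≤ m)
    (hP : ∀ k : ℕ, 0 < k → k ≤ 2 * m → ¬ HasNonsingularReduction R W (k • P)) :
    ¬ π ∣ (W.integralModel R).c₄ ∧ π ^ (2 * m) ∣ (W.integralModel R).Δ := by
  have hs : ∀ k : ℕ, 0 < k → k ≤ 2 * m → ∃ x y, SingularReduction R π W (k • P) x y :=
    fun k h0 hk => exists_singularReduction hπ (hP k h0 hk)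
  choose! x y hxy using hs
  have h1 := hxy 1 (by omega) (by omega)
  have h2 := hxy 2 (by omega) (by omega)
  have h3 := hxy 3 (by omega) (by omega)
  have h4 := hxy 4 (by omega) (by omega)
  rw [one_smul] at h1
  rw [two_smul] at h2
  rw [show 3 • P = P + (P + P) by abel] at h3
  rw [show 4 • P = (P + P) + (P + P) by abel] at h4
  obtain ⟨l, hl, hnode, hc₄⟩ := exists_node_tangent hπ hΔ h1 h2 h3 h4
  refine ⟨hc₄, ?_⟩
  set ψ : ℕ → R := fun k =>
    2 * y k + (W.integralModel R).a₁ * x k + (W.integralModel R).a₃ with hψ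
  have hne : ∀ i j : ℕ, 0 < i → i < j → j ≤ m → emultiplicity π (ψ j) ≠ emultiplicity π (ψ i) := by
    intro i j hi hij hj
    have hsub : j • P + -(i • P) = (j - i) • P :=
      (sub_nsmul P hij.le).symm
    have hji := hxy (j - i) (by omega) (by omega)
    rw [← hsub] at hji
    have hadd := hxy (j + i) (by omega) (by omega)
    rw [add_smul] at hadd
    have hj' := hxy j (by omega) (by omega)
    refine multiplicity_ne_of_singularReduction (l := l) hπ hj' (hxy i hi (by omega)) hadd hji ?_
      hnode ?_
    · have := (hj'.1.congr hπ.prime h1.1).1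
      convert hl.sub (this.mul_left 3) using 1
      ring
    · intro h
      refine hP (j - i) (by omega) (by omega) ?_
      rw [← hsub, h, add_neg_cancel]
      exact trivial
  -- Otherwise m pairwise distinct valuations would lie in {1, …, m - 1}.
  have hex : ∃ k, 0 < k ∧ k ≤ m ∧ π ^ m ∣ ψ k := by
    by_contra! hcon
    have hfin : ∀ k, 0 < k → k ≤ m → FiniteMultiplicity π (ψ k) ∧
        multiplicity π (ψ k) < m ∧ 0 < multiplicity π (ψ k) := by
      intro k h0 hk
      have hf : FiniteMultiplicity π (ψ k) := by
        by_contra hinf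
        exact hcon k h0 hk (FiniteMultiplicity.not_iff_forall.1 hinf m)
      refine ⟨hf, hf.multiplicity_lt_iff_not_dvd.2 (hcon k h0 hk), ?_⟩
      rw [Nat.pos_iff_ne_zero, Ne, multiplicity_eq_zero, not_not]
      exact (hxy k h0 (by omega)).1.dvd_Y
    obtain ⟨i, hi, j, hj, hij, he⟩ := Finset.exists_ne_map_eq_of_card_lt_of_maps_to
      (s := Finset.Icc 1 m) (t := Finset.Ico 1 m) (f := fun k => multiplicity π (ψ k))
      (by simp; omega) (by
        intro k hk
        rw [Finset.coe_Icc, Set.mem_Icc] at hk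
        have := hfin k (by omega) hk.2
        simp only [Finset.coe_Ico, Set.mem_Ico]
        omega)
    rw [Finset.mem_Icc] at hi hj
    have hfi := (hfin i (by omega) hi.2).1
    have hfj := (hfin j (by omega) hj.2).1
    have he' : emultiplicity π (ψ i) = emultiplicity π (ψ j) := by
      rw [hfi.emultiplicity_eq_multiplicity, hfj.emultiplicity_eq_multiplicity, he]
    rcases lt_or_gt_of_ne hij with h | h
    · exact hne i j (by omega) h hj.2 he'.symm
    · exact hne j i (by omega) h hi.2 he'
  obtain ⟨k, h0, hk, hdvd⟩ := hex
  have hk1 := hxy k h0 (by omega)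
  -- As 2k ≤ 2m, the double of kP is also singular modulo π, so the tangent at kP has integral slope
  -- and ψ(kP)² divides Δ.
  have hk2 := hxy (k + k) (by omega) (by omega)
  rw [add_smul] at hk2
  obtain ⟨t, -, ht, -⟩ := hk1.exists_slope hπ hk1 hk2
  refine dvd_trans ?_ (sq_dvd_Δ_of_slope _ hk1.1.equation (ht rfl))
  rw [mul_comm, pow_mul]
  exact pow_dvd_pow_of_dvd hdvd 2

/-- If an odd prime `p ≥ 5` divides the Tamagawa number (which is assumed finite), then the
reduction is multiplicative and the minimal discriminant has valuation at least `p - 1`. -/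
theorem dvd_Δ_of_dvd_localTamagawaNumber {π : R} (hπ : Irreducible π) {p : ℕ} (hp : p.Prime)
    (hp5 : 5 ≤ p) {W : WeierstrassCurve K} (hΔ : (W.minimal R).Δ ≠ 0)
    (h0 : localTamagawaNumber R W ≠ 0) (hdvd : p ∣ localTamagawaNumber R W) :
    ¬ π ∣ ((W.minimal R).integralModel R).c₄ ∧
      π ^ (p - 1) ∣ ((W.minimal R).integralModel R).Δ := by
  classical
  have : Fact p.Prime := ⟨hp⟩
  set H := nonsingularReductionSubgroup R (W.minimal R) with hH
  have hfin : Finite ((W.minimal R).toAffine.Point ⧸ H) :=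
    Nat.finite_of_card_ne_zero h0
  obtain ⟨q, hq⟩ := exists_prime_addOrderOf_dvd_card' (G := (W.minimal R).toAffine.Point ⧸ H) p hdvd
  obtain ⟨P, rfl⟩ := QuotientAddGroup.mk_surjective q
  obtain ⟨m, hm⟩ : ∃ m, p = 2 * m + 1 := hp.odd_of_ne_two (by omega)
  have := dvd_Δ_of_multiples hπ hΔ (P := P) (m := m) (by omega) (by
    intro k hk0 hk hns
    -- Only the inclusion of the nonsingular points in the subgroup they generate is used, not that
    -- they form a subgroup.
    have hmem : k • P ∈ H := AddSubgroup.subset_closure hns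
    rw [← QuotientAddGroup.eq_zero_iff, QuotientAddGroup.mk_nsmul,
      ← addOrderOf_dvd_iff_nsmul_eq_zero, hq] at hmem
    have := Nat.le_of_dvd hk0 hmem
    omega)
  rwa [show p - 1 = 2 * m by omega]

end Reduction

/-! ### From Tamagawa divisibility to congruences on A and B. -/

section Tamagawa

open WeierstrassCurve

/-- The numerical condition at `l` on a curve `y² = x³ + A x + B` that is forced by the
divisibility of its Tamagawa number at `l` by `p`: the minimal model, obtained by scaling by
`l ^ k`, has multiplicative reduction and a discriminant of valuation at least `p - 1`. -/
def IsDeepMultiplicative (p l : ℕ) (A B : ℤ) : Prop :=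
  ∃ k : ℕ, (l : ℤ) ^ (4 * k) ∣ 48 * A ∧ ¬ (l : ℤ) ^ (4 * k + 1) ∣ 48 * A ∧
    (l : ℤ) ^ (12 * k + (p - 1)) ∣ 16 * (4 * A ^ 3 + 27 * B ^ 2)

theorem shortCurve_c₄ {R : Type*} [CommRing R] (a b : R) : (shortCurve a b).c₄ = -48 * a := by
  simp only [shortCurve, WeierstrassCurve.c₄, WeierstrassCurve.b₂, WeierstrassCurve.b₄]
  ring

/-- c₄ and Δ see only the scaling factor u of the change to the minimal model. With k = v(u), a unit
c₄ forces v(48A) = 4k exactly, and v(Δ) ≥ p - 1 becomes a bound shifted by 12k. -/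
theorem isDeepMultiplicative_of_dvd_tamagawaNumber {p l : ℕ} [Fact l.Prime] (hp : p.Prime)
    (hp5 : 5 ≤ p) (c : CurveClass) (h0 : tamagawaNumber l c.curve ≠ 0)
    (hdvd : p ∣ tamagawaNumber l c.curve) : IsDeepMultiplicative p l c.A c.B := by
  have hl : (l : ℚ_[l]) ≠ 0 := by exact_mod_cast (Fact.out : l.Prime).ne_zero
  set W := c.curve.baseChange ℚ_[l] with hW
  have hWc : W = shortCurve (c.A : ℚ_[l]) (c.B : ℚ_[l]) := by
    rw [hW, CurveClass.curve]
    ext <;> simp [shortCurve, baseChange]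
  have hWΔ : W.Δ ≠ 0 := by
    rw [hWc, shortCurve_Δ]
    have := c.isMinimalPair.1
    have : (4 * (c.A : ℚ_[l]) ^ 3 + 27 * (c.B : ℚ_[l]) ^ 2) ≠ 0 := by exact_mod_cast this
    simpa using this
  obtain ⟨C, hC⟩ : ∃ C : VariableChange ℚ_[l], W.minimal ℤ_[l] = C • W := ⟨_, rfl⟩
  have hmΔ : (W.minimal ℤ_[l]).Δ ≠ 0 := by
    rw [hC, variableChange_Δ]
    exact mul_ne_zero (pow_ne_zero _ (Units.ne_zero _)) hWΔ
  obtain ⟨h4, hΔ⟩ := dvd_Δ_of_dvd_localTamagawaNumber (PadicInt.prime_p (p := l)).irreducible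
    hp hp5 hmΔ h0 hdvd
  have e4 : ‖(W.minimal ℤ_[l]).c₄‖ = 1 := by
    rw [← integralModel_c₄_eq ℤ_[l]]
    by_contra hne
    apply h4
    rw [← PadicInt.norm_lt_one_iff_dvd]
    exact lt_of_le_of_ne (PadicInt.norm_le_one _) hne
  have eΔ : ‖(W.minimal ℤ_[l]).Δ‖ ≤ (l : ℝ) ^ (-((p - 1 : ℕ) : ℤ)) := by
    rw [← integralModel_Δ_eq ℤ_[l]]
    have := (PadicInt.norm_le_pow_iff_mem_span_pow _ (p - 1)).2 (Ideal.mem_span_singleton.2 hΔ)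
    exact this
  rw [hC, variableChange_c₄, hWc, shortCurve_c₄, Units.val_inv_eq_inv_val] at e4
  rw [hC, variableChange_Δ, hWc, shortCurve_Δ, Units.val_inv_eq_inv_val] at eΔ
  set k := (C.u : ℚ_[l]).valuation with hk
  have hl0 : (0 : ℝ) < l := by exact_mod_cast (Fact.out : l.Prime).pos
  have hl1 : (1 : ℝ) < l := by exact_mod_cast (Fact.out : l.Prime).one_lt
  have hu : ‖(C.u : ℚ_[l])‖ = (l : ℝ) ^ (-k) := Padic.norm_eq_zpow_neg_valuation C.u.ne_zero
  have f4 : ‖((48 * c.A : ℤ) : ℚ_[l])‖ = (l : ℝ) ^ (-(4 * k)) := by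
    rw [norm_mul, norm_pow, norm_inv, hu, ← zpow_neg, ← zpow_natCast, ← zpow_mul] at e4
    have : ‖(-48 * (c.A : ℚ_[l]))‖ = ‖((48 * c.A : ℤ) : ℚ_[l])‖ := by
      rw [← norm_neg]; push_cast; ring_nf
    rw [this] at e4
    rw [eq_comm, ← mul_right_inj' (zpow_ne_zero (- -k * (4 : ℕ)) hl0.ne'), e4, ← zpow_add₀ hl0.ne']
    norm_num [mul_comm]
  have fΔ : ‖((16 * (4 * c.A ^ 3 + 27 * c.B ^ 2) : ℤ) : ℚ_[l])‖ ≤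
      (l : ℝ) ^ (-(12 * k + (p - 1 : ℕ))) := by
    rw [norm_mul, norm_pow, norm_inv, hu, ← zpow_neg, ← zpow_natCast, ← zpow_mul] at eΔ
    have : ‖(-16 * (4 * (c.A : ℚ_[l]) ^ 3 + 27 * (c.B : ℚ_[l]) ^ 2))‖ =
        ‖((16 * (4 * c.A ^ 3 + 27 * c.B ^ 2) : ℤ) : ℚ_[l])‖ := by
      rw [← norm_neg]; push_cast; ring_nf
    rw [this] at eΔ
    rw [← mul_le_mul_iff_right₀ (zpow_pos hl0 (- -k * (12 : ℕ)))]
    refine eΔ.trans_eq ?_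
    rw [← zpow_add₀ hl0.ne']
    congr 1
    push_cast
    ring
  have hk0 : 0 ≤ k := by
    have := Padic.norm_int_le_one (p := l) (48 * c.A)
    rw [f4] at this
    by_contra hneg
    exact absurd this (not_le.2 (one_lt_zpow₀ hl1 (by omega)))
  obtain ⟨n, hn⟩ := Int.eq_ofNat_of_zero_le hk0
  rw [hn] at f4 fΔ
  refine ⟨n, ?_, ?_, ?_⟩
  · have := (Padic.norm_int_le_pow_iff_dvd (p := l) (48 * c.A) (4 * n)).1
      (by rw [f4]; push_cast; rfl)
    exact_mod_cast this
  · intro h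
    have := (Padic.norm_int_le_pow_iff_dvd (p := l) (48 * c.A) (4 * n + 1)).2 (by exact_mod_cast h)
    rw [f4, zpow_le_zpow_iff_right₀ hl1] at this
    push_cast at this
    omega
  · have := (Padic.norm_int_le_pow_iff_dvd (p := l) _ (12 * n + (p - 1))).1
      (fΔ.trans_eq (by push_cast; rfl))
    exact_mod_cast this

theorem exists_isDeepMultiplicative {p : ℕ} (hp : p.Prime) (hp5 : 5 ≤ p) {c : CurveClass}
    (hc : c ∈ tamagawaSet p) : ∃ l : ℕ, l.Prime ∧ IsDeepMultiplicative p l c.A c.B := by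
  have hc' : p ∣ ∏ᶠ l : Nat.Primes, haveI : Fact (l : ℕ).Prime := ⟨l.2⟩
      tamagawaPart p l c.curve := hc
  obtain ⟨l, hl⟩ : ∃ l : Nat.Primes, haveI : Fact (l : ℕ).Prime := ⟨l.2⟩
      p ∣ tamagawaPart p l c.curve := by
    by_contra! hcon
    -- Finiteness of the support is not needed: the default value 1 of the product is not divisible
    -- by p either.
    refine finprod_induction (p := fun n : ℕ => ¬ p ∣ n) ?_ ?_ hcon hc'
    · exact hp.not_dvd_one
    · intro x y hx hy
      exact hp.not_dvd_mul hx hy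
  have : Fact (l : ℕ).Prime := ⟨l.2⟩
  refine ⟨l, l.2, ?_⟩
  have hv : padicValNat p (tamagawaNumber l c.curve) ≠ 0 := by
    intro h
    rw [tamagawaPart, h, pow_zero] at hl
    exact hp.not_dvd_one hl
  refine isDeepMultiplicative_of_dvd_tamagawaNumber hp hp5 c ?_ (dvd_of_one_le_padicValNat
    (Nat.one_le_iff_ne_zero.2 hv))
  -- An infinite index is recorded as 0, and `padicValNat p 0 = 0`.
  intro h
  simp [h] at hv

theorem IsMinimalPair.not_dvd {A B : ℤ} (h : IsMinimalPair A B) {l : ℕ} (hl : 1 < l)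
    (hA : (l : ℤ) ^ 4 ∣ A) : ¬ (l : ℤ) ^ 6 ∣ B :=
  fun hB => h.2 l hl ((pow_dvd_gcd_iff A B l).2 ⟨hA, hB⟩)

/-- The modulus for which `A` determines `B` up to sign in `IsDeepMultiplicative p l A B`. -/
def deepModulus (p l : ℕ) : ℕ := if l = 2 then 2 ^ (p + 5) else if l = 3 then 3 ^ (p + 5)
  else l ^ (p - 1)

/-- The factors b - b' and b + b' sum to 2b, which is prime to l, so one of them absorbs the whole
power. -/
theorem dvd_sub_or_dvd_add {l : ℤ} (hl : Prime l) (h2 : ¬ l ∣ 2) {b b' : ℤ} (hb : ¬ l ∣ b) {n : ℕ}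
    (h : l ^ n ∣ b ^ 2 - b' ^ 2) : l ^ n ∣ b - b' ∨ l ^ n ∣ b + b' := by
  rw [show b ^ 2 - b' ^ 2 = (b - b') * (b + b') by ring] at h
  by_cases h1 : l ∣ b - b'
  · left
    have h3 : ¬ l ∣ b + b' := fun h3 => by
      have := h1.add h3
      rw [show b - b' + (b + b') = 2 * b by ring] at this
      exact (hl.dvd_or_dvd this).elim h2 hb
    exact hl.pow_dvd_of_dvd_mul_right n h3 h
  · right
    exact hl.pow_dvd_of_dvd_mul_left n h1 h

/-- Both factors are even and their halves sum to the odd number b. Hence one factor contains 2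
exactly once, which costs one in the exponent. -/
theorem dvd_sub_or_dvd_add_two {b b' : ℤ} (hb : ¬ 2 ∣ b) (hb' : ¬ 2 ∣ b') {n : ℕ}
    (h : 2 ^ (n + 1) ∣ b ^ 2 - b' ^ 2) : 2 ^ n ∣ b - b' ∨ 2 ^ n ∣ b + b' := by
  obtain ⟨s, hs⟩ : (2 : ℤ) ∣ b - b' := by omega
  obtain ⟨t, ht⟩ : (2 : ℤ) ∣ b + b' := by omega
  have h2 : Prime (2 : ℤ) := Int.prime_two
  rw [show b ^ 2 - b' ^ 2 = (b - b') * (b + b') by ring] at h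
  by_cases h1 : (2 : ℤ) ∣ s
  · left
    have h3 : ¬ (2 : ℤ) ∣ t := by omega
    rw [ht, show (b - b') * (2 * t) = 2 * ((b - b') * t) by ring, pow_succ',
      mul_dvd_mul_iff_left two_ne_zero] at h
    exact h2.pow_dvd_of_dvd_mul_right n h3 h
  · right
    rw [hs, show 2 * s * (b + b') = 2 * (s * (b + b')) by ring, pow_succ',
      mul_dvd_mul_iff_left two_ne_zero] at h
    exact h2.pow_dvd_of_dvd_mul_left n h1 h

/-- Here l is prime to 48 and 27, so l^(4k) ∣ A and l^(6k) ∣ B, and minimality of the pair forces k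
= 0. -/
theorem IsDeepMultiplicative.of_five_le {p l : ℕ} (hl : l.Prime) (hl5 : 5 ≤ l) {A B : ℤ}
    (hm : IsMinimalPair A B) (h : IsDeepMultiplicative p l A B) :
    ¬ (l : ℤ) ∣ A ∧ (l : ℤ) ^ (p - 1) ∣ 4 * A ^ 3 + 27 * B ^ 2 := by
  obtain ⟨k, h1, h2, h3⟩ := h
  have hlp : Prime (l : ℤ) := Nat.prime_iff_prime_int.1 hl
  have n2 : ¬ (l : ℤ) ∣ 2 := fun h => by
    have := Nat.le_of_dvd (by norm_num) (Int.natCast_dvd_natCast.1 (by exact_mod_cast h) : l ∣ 2)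
    omega
  have n3 : ¬ (l : ℤ) ∣ 3 := fun h => by
    have := Nat.le_of_dvd (by norm_num) (Int.natCast_dvd_natCast.1 (by exact_mod_cast h) : l ∣ 3)
    omega
  have n16 : ¬ (l : ℤ) ∣ 16 := fun h => n2 (hlp.dvd_of_dvd_pow (n := 4) (by norm_num; exact h))
  have n27 : ¬ (l : ℤ) ∣ 27 := fun h => n3 (hlp.dvd_of_dvd_pow (n := 3) (by norm_num; exact h))
  have n48 : ¬ (l : ℤ) ∣ 48 := fun h => by
    rw [show (48 : ℤ) = 16 * 3 by norm_num] at h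
    exact (hlp.dvd_or_dvd h).elim n16 n3
  replace h1 := hlp.pow_dvd_of_dvd_mul_left _ n48 h1
  replace h3 := hlp.pow_dvd_of_dvd_mul_left _ n16 h3
  have hB : (l : ℤ) ^ (6 * k) ∣ B := by
    have a1 : (l : ℤ) ^ (12 * k) ∣ 4 * A ^ 3 := by
      rw [show 12 * k = 4 * k * 3 by ring, pow_mul]
      exact (pow_dvd_pow_of_dvd h1 3).mul_left 4
    have a2 := hlp.pow_dvd_of_dvd_mul_left _ n27
      ((dvd_add_right a1).1 ((pow_dvd_pow _ (by omega)).trans h3))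
    rwa [show 12 * k = 6 * k * 2 by ring, pow_mul, Int.pow_dvd_pow_iff two_ne_zero] at a2
  rcases Nat.eq_zero_or_pos k with rfl | hk
  · refine ⟨fun h => h2 (by simpa using h.mul_left 48), by simpa using h3⟩
  · exact absurd ((pow_dvd_pow _ (by omega)).trans hB)
      (hm.not_dvd hl.one_lt ((pow_dvd_pow _ (by omega)).trans h1))

/-- The factor 3 of 48 excludes k = 0, and minimality excludes k ≥ 2. At k = 1 both coefficients are
divisible by 27, and removing 3⁹ from 3^(12 + p - 1) leaves 3^(p + 2). -/
theorem IsDeepMultiplicative.of_three {p : ℕ} (hp5 : 5 ≤ p) {A B : ℤ}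
    (hm : IsMinimalPair A B) (h : IsDeepMultiplicative p 3 A B) :
    ∃ a b : ℤ, A = 27 * a ∧ B = 27 * b ∧ ¬ 3 ∣ a ∧ 3 ^ (p + 2) ∣ 4 * a ^ 3 + b ^ 2 := by
  obtain ⟨k, h1, h2, h3⟩ := h
  rw [Nat.cast_ofNat] at h1 h2 h3
  have hlp : Prime (3 : ℤ) := Int.prime_three
  have n16 : ¬ (3 : ℤ) ∣ 16 := by norm_num
  obtain ⟨j, rfl⟩ : ∃ j, k = j + 1 := by
    refine Nat.exists_eq_succ_of_ne_zero ?_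
    rintro rfl
    exact h2 (by simpa using (show (3 : ℤ) ∣ 48 by norm_num).mul_right A)
  replace h1 : (3 : ℤ) ^ (4 * j + 3) ∣ A := by
    refine hlp.pow_dvd_of_dvd_mul_left _ n16 ?_
    rwa [show 48 * A = 3 * (16 * A) by ring, show 4 * (j + 1) = 4 * j + 3 + 1 by ring, pow_succ',
      mul_dvd_mul_iff_left three_ne_zero] at h1
  replace h3 := hlp.pow_dvd_of_dvd_mul_left _ n16 h3
  have hB : (3 : ℤ) ^ (6 * j + 3) ∣ B := by
    have a1 : (3 : ℤ) ^ (12 * j + 9) ∣ 4 * A ^ 3 := by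
      rw [show 12 * j + 9 = (4 * j + 3) * 3 by ring, pow_mul]
      exact (pow_dvd_pow_of_dvd h1 3).mul_left 4
    have a2 := (dvd_add_right a1).1 ((pow_dvd_pow _ (by omega)).trans h3)
    rw [show 12 * j + 9 = 3 + (6 * j + 3) * 2 by ring, pow_add, pow_mul _ (6 * j + 3),
      show (27 : ℤ) = 3 ^ 3 by norm_num, mul_dvd_mul_iff_left (by norm_num),
      Int.pow_dvd_pow_iff two_ne_zero] at a2
    exact a2
  rcases Nat.eq_zero_or_pos j with rfl | hk
  · obtain ⟨a, rfl⟩ := h1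
    obtain ⟨b, rfl⟩ := hB
    refine ⟨a, b, by norm_num, by norm_num, ?_, ?_⟩
    · rintro ⟨d, rfl⟩
      exact h2 ⟨16 * d, by ring⟩
    · rw [show 4 * ((3 : ℤ) ^ (4 * 0 + 3) * a) ^ 3 + 27 * (3 ^ (6 * 0 + 3) * b) ^ 2 =
        3 ^ 9 * (4 * a ^ 3 + b ^ 2) by ring,
        show 12 * (0 + 1) + (p - 1) = 9 + (p + 2) by omega, pow_add,
        mul_dvd_mul_iff_left (by norm_num)] at h3
      exact h3
  · exact absurd ((pow_dvd_pow _ (by omega)).trans hB)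
      (hm.not_dvd (l := 3) (by norm_num) ((pow_dvd_pow _ (by omega)).trans h1))

/-- The factor 16 of 48 excludes k = 0, and minimality excludes k ≥ 2. At k = 1 the factor 16 and
the common factor 4 leave 2^(12 + p - 1 - 6) = 2^(p + 5). -/
theorem IsDeepMultiplicative.of_two {p : ℕ} (hp5 : 5 ≤ p) {A B : ℤ}
    (hm : IsMinimalPair A B) (h : IsDeepMultiplicative p 2 A B) :
    ∃ b : ℤ, B = 2 * b ∧ ¬ 2 ∣ A ∧ 2 ^ (p + 5) ∣ A ^ 3 + 27 * b ^ 2 := by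
  obtain ⟨k, h1, h2, h3⟩ := h
  rw [Nat.cast_ofNat] at h1 h2 h3
  have hlp : Prime (2 : ℤ) := Int.prime_two
  have n3 : ¬ (2 : ℤ) ∣ 3 := by norm_num
  obtain ⟨j, rfl⟩ : ∃ j, k = j + 1 := by
    refine Nat.exists_eq_succ_of_ne_zero ?_
    rintro rfl
    exact h2 (by simpa using (show (2 : ℤ) ∣ 48 by norm_num).mul_right A)
  replace h1 : (2 : ℤ) ^ (4 * j) ∣ A := by
    refine hlp.pow_dvd_of_dvd_mul_left _ n3 ?_
    rwa [show 48 * A = 2 ^ 4 * (3 * A) by ring, show 4 * (j + 1) = 4 + 4 * j by ring, pow_add,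
      mul_dvd_mul_iff_left (by norm_num)] at h1
  replace h3 : (2 : ℤ) ^ (12 * j + p + 7) ∣ 4 * A ^ 3 + 27 * B ^ 2 := by
    rwa [show (16 : ℤ) = 2 ^ 4 by norm_num,
      show 12 * (j + 1) + (p - 1) = 4 + (12 * j + p + 7) by omega, pow_add,
      mul_dvd_mul_iff_left (by norm_num)] at h3
  have hB : (2 : ℤ) ^ (6 * j + 1) ∣ B := by
    have a1 : (2 : ℤ) ^ (12 * j + 2) ∣ 4 * A ^ 3 := by
      rw [show 12 * j + 2 = 2 + 4 * j * 3 by ring, pow_add, pow_mul _ (4 * j)]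
      exact mul_dvd_mul (by norm_num) (pow_dvd_pow_of_dvd h1 3)
    have a2 := hlp.pow_dvd_of_dvd_mul_left _ (by norm_num)
      ((dvd_add_right a1).1 ((pow_dvd_pow _ (by omega)).trans h3))
    rwa [show 12 * j + 2 = (6 * j + 1) * 2 by ring, pow_mul, Int.pow_dvd_pow_iff two_ne_zero] at a2
  rcases Nat.eq_zero_or_pos j with rfl | hk
  · obtain ⟨b, rfl⟩ := hB
    refine ⟨b, by norm_num, ?_, ?_⟩
    · rintro ⟨d, rfl⟩
      exact h2 ⟨3 * d, by ring⟩
    · rw [show 4 * A ^ 3 + 27 * ((2 : ℤ) ^ (6 * 0 + 1) * b) ^ 2 =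
        2 ^ 2 * (A ^ 3 + 27 * b ^ 2) by ring,
        show 12 * 0 + p + 7 = 2 + (p + 5) by omega, pow_add,
        mul_dvd_mul_iff_left (by norm_num)] at h3
      exact h3
  · exact absurd ((pow_dvd_pow _ (by omega)).trans hB)
      (hm.not_dvd (l := 2) (by norm_num) ((pow_dvd_pow _ (by omega)).trans h1))

/-- Fixing A fixes the square of the l-free part of B modulo a power of l. The forced factor of B (2
or 27 at the small primes) is then put back into the modulus; at l = 2 it compensates the exponent
lost in the square root. -/
theorem IsDeepMultiplicative.dvd_sub_or_dvd_add {p l : ℕ} (hp5 : 5 ≤ p) (hl : l.Prime)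
    {A B B' : ℤ} (hm : IsMinimalPair A B) (hm' : IsMinimalPair A B')
    (h : IsDeepMultiplicative p l A B) (h' : IsDeepMultiplicative p l A B') :
    (deepModulus p l : ℤ) ∣ B - B' ∨ (deepModulus p l : ℤ) ∣ B + B' := by
  rw [deepModulus]
  split_ifs with hl2 hl3
  · subst hl2
    obtain ⟨b, rfl, hA, hb⟩ := h.of_two hp5 hm
    obtain ⟨b', rfl, -, hb'⟩ := h'.of_two hp5 hm'
    have odd : ∀ t : ℤ, 2 ^ (p + 5) ∣ A ^ 3 + 27 * t ^ 2 → ¬ 2 ∣ t := by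
      rintro t ht ⟨d, rfl⟩
      refine hA (Int.prime_two.dvd_of_dvd_pow (n := 3) ?_)
      exact (dvd_add_left (Dvd.intro (54 * d ^ 2) (by ring))).1
        ((dvd_pow_self 2 (by omega)).trans ht)
    have hd : (2 : ℤ) ^ (p + 4 + 1) ∣ b ^ 2 - b' ^ 2 := by
      refine Int.prime_two.pow_dvd_of_dvd_mul_left _ (show ¬ (2 : ℤ) ∣ 27 by norm_num) ?_
      convert hb.sub hb' using 1
      ring
    have := dvd_sub_or_dvd_add_two (odd b hb) (odd b' hb') hd
    push_cast
    rw [← mul_sub, ← mul_add, pow_succ', mul_dvd_mul_iff_left two_ne_zero,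
      mul_dvd_mul_iff_left two_ne_zero]
    exact this
  · subst hl3
    obtain ⟨a, b, rfl, rfl, ha, hb⟩ := h.of_three hp5 hm
    obtain ⟨a', b', haa, rfl, -, hb'⟩ := h'.of_three hp5 hm'
    obtain rfl : a = a' := by omega
    have hb3 : ¬ 3 ∣ b := by
      rintro ⟨d, rfl⟩
      have := (dvd_add_left (Dvd.intro (3 * d ^ 2) (by ring))).1
        ((dvd_pow_self 3 (by omega)).trans hb)
      exact ha (Int.prime_three.dvd_of_dvd_pow
        ((Int.prime_three.dvd_or_dvd this).resolve_left (by norm_num)))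
    have hd : (3 : ℤ) ^ (p + 2) ∣ b ^ 2 - b' ^ 2 := by
      rw [show b ^ 2 - b' ^ 2 = (4 * a ^ 3 + b ^ 2) - (4 * a ^ 3 + b' ^ 2) by ring]
      exact hb.sub hb'
    have := EllipticDensity.dvd_sub_or_dvd_add Int.prime_three (by norm_num) hb3 hd
    push_cast
    rw [← mul_sub, ← mul_add, show p + 5 = 3 + (p + 2) by ring, pow_add,
      show (27 : ℤ) = 3 ^ 3 by norm_num, mul_dvd_mul_iff_left (by norm_num),
      mul_dvd_mul_iff_left (by norm_num)]
    exact this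
  · have hl5 : 5 ≤ l := by
      have := hl.two_le
      have : l ≠ 4 := by rintro rfl; norm_num at hl
      omega
    have hlp : Prime (l : ℤ) := Nat.prime_iff_prime_int.1 hl
    have n2 : ¬ (l : ℤ) ∣ 2 := fun h => by
      have := Nat.le_of_dvd (by norm_num) (Int.natCast_dvd_natCast.1 (by exact_mod_cast h) : l ∣ 2)
      omega
    have n3 : ¬ (l : ℤ) ∣ 3 := fun h => by
      have := Nat.le_of_dvd (by norm_num) (Int.natCast_dvd_natCast.1 (by exact_mod_cast h) : l ∣ 3)
      omega
    obtain ⟨hA, hb⟩ := h.of_five_le hl hl5 hm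
    obtain ⟨-, hb'⟩ := h'.of_five_le hl hl5 hm'
    have hB : ¬ (l : ℤ) ∣ B := by
      rintro ⟨d, rfl⟩
      have := (dvd_add_left (Dvd.intro (27 * l * d ^ 2) (by ring))).1
        ((dvd_pow_self (l : ℤ) (by omega)).trans hb)
      rcases hlp.dvd_or_dvd this with h | h
      · exact n2 (hlp.dvd_of_dvd_pow (n := 2) (by norm_num; exact h))
      · exact hA (hlp.dvd_of_dvd_pow h)
    have hd : (l : ℤ) ^ (p - 1) ∣ B ^ 2 - B' ^ 2 := by
      refine hlp.pow_dvd_of_dvd_mul_left _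
        (show ¬ (l : ℤ) ∣ 27 from fun h => n3 (hlp.dvd_of_dvd_pow (n := 3) (by norm_num; exact h))) ?_
      convert hb.sub hb' using 1
      ring
    push_cast
    exact EllipticDensity.dvd_sub_or_dvd_add hlp n2 hB hd

/-- This bounds l by a multiple of X^(1/4), so that few primes contribute a rounding error. -/
theorem IsDeepMultiplicative.pow_four_dvd {p l : ℕ} (hp5 : 5 ≤ p) (hl : l.Prime)
    {A B : ℤ} (hm : IsMinimalPair A B) (h : IsDeepMultiplicative p l A B) :
    (l : ℤ) ^ 4 ∣ 4 * A ^ 3 + 27 * B ^ 2 := by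
  by_cases hl2 : l = 2
  · subst hl2
    obtain ⟨b, rfl, -, hb⟩ := h.of_two hp5 hm
    rw [show 4 * A ^ 3 + 27 * (2 * b) ^ 2 = 4 * (A ^ 3 + 27 * b ^ 2) by ring]
    exact ((pow_dvd_pow _ (by omega)).trans hb).mul_left 4
  by_cases hl3 : l = 3
  · subst hl3
    obtain ⟨a, b, rfl, rfl, -, -⟩ := h.of_three hp5 hm
    exact ⟨972 * a ^ 3 + 243 * b ^ 2, by push_cast; ring⟩
  have hl5 : 5 ≤ l := by
    have := hl.two_le
    have : l ≠ 4 := by rintro rfl; norm_num at hl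
    omega
  exact (pow_dvd_pow _ (by omega)).trans (h.of_five_le hl hl5 hm).2

end Tamagawa

open Topology

/-! ### Counting integers in residue classes -/

/-- The number of integers `x` with `|x| < a` in the residue class of `v` modulo `q`. -/
def residueCount (a q v : ℤ) : ℕ := ((Finset.Ioo (-a) a).filter (fun x => x ≡ v [ZMOD q])).card

theorem residueCount_eq {a q : ℤ} (hq : 0 < q) (v : ℤ) :
    (residueCount a q v : ℤ) =
      max (⌊((a - 1 : ℤ) - v) / (q : ℝ)⌋ - ⌊((-a : ℤ) - v) / (q : ℝ)⌋) 0 := by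
  have h : Finset.Ioo (-a) a = Finset.Ioc (-a) (a - 1) := by
    ext x
    simp only [Finset.mem_Ioo, Finset.mem_Ioc]
    omega
  have h1 : ∀ z : ℤ, ⌊((z : ℝ) - v) / (q : ℝ)⌋ = ⌊((z : ℚ) - v) / (q : ℚ)⌋ := by
    intro z
    have := Rat.floor_cast (α := ℝ) (((z : ℚ) - v) / (q : ℚ))
    push_cast at this
    exact this
  rw [residueCount, h, Int.Ioc_filter_modEq_card _ _ hq, h1, h1]

theorem residueCount_le {a q : ℤ} (ha : 0 ≤ a) (hq : 0 < q) (v : ℤ) :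
    (residueCount a q v : ℝ) ≤ 2 * a / q + 1 := by
  have hq' : (0 : ℝ) < q := by exact_mod_cast hq
  have ha' : (0 : ℝ) ≤ a := by exact_mod_cast ha
  have h : ((residueCount a q v : ℤ) : ℝ) ≤ 2 * a / q + 1 := by
    rw [residueCount_eq hq, Int.cast_max, max_le_iff]
    constructor
    · have h1 := Int.floor_le (((a - 1 : ℤ) - v) / (q : ℝ))
      have h2 := Int.lt_floor_add_one (((-a : ℤ) - v) / (q : ℝ))
      have h3 : ((a - 1 : ℤ) - v) / (q : ℝ) - ((-a : ℤ) - v) / (q : ℝ) = 2 * a / q - 1 / q := by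
        push_cast; ring
      have h4 : 0 < 1 / (q : ℝ) := by positivity
      push_cast at *
      linarith
    · push_cast
      positivity
  exact_mod_cast h

theorem le_residueCount {a q : ℤ} (hq : 0 < q) (v : ℤ) :
    (2 * a / q - 2 : ℝ) ≤ residueCount a q v := by
  have hq' : (1 : ℝ) ≤ q := by exact_mod_cast hq
  have h : (2 * a / q - 2 : ℝ) ≤ ((residueCount a q v : ℤ) : ℝ) := by
    rw [residueCount_eq hq, Int.cast_max]
    refine le_max_of_le_left ?_
    have h1 := Int.lt_floor_add_one (((a - 1 : ℤ) - v) / (q : ℝ))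
    have h2 := Int.floor_le (((-a : ℤ) - v) / (q : ℝ))
    have h3 : ((a - 1 : ℤ) - v) / (q : ℝ) - ((-a : ℤ) - v) / (q : ℝ) = 2 * a / q - 1 / q := by
      push_cast; ring
    have h4 : 1 / (q : ℝ) ≤ 1 := by
      rw [div_le_one (by linarith)]; exact hq'
    push_cast at *
    linarith
  exact_mod_cast h

theorem tendsto_ceil_div {f : ℝ → ℝ} (hf : Tendsto f atTop atTop) :
    Tendsto (fun X => (⌈f X⌉ : ℝ) / f X) atTop (𝓝 1) := by
  refine ((tendsto_nat_ceil_div_atTop (R := ℝ)).comp hf).congr' ?_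
  filter_upwards [hf.eventually_ge_atTop 0] with X hX
  simp only [Function.comp, natCast_ceil_eq_intCast_ceil hX]

theorem tendsto_const_div {f : ℝ → ℝ} (hf : Tendsto f atTop atTop) (c : ℝ) :
    Tendsto (fun X => c / f X) atTop (𝓝 0) :=
  tendsto_const_nhds.div_atTop hf

theorem tendsto_residueCount_bound {f : ℝ → ℝ} (hf : Tendsto f atTop atTop) (q c : ℝ) :
    Tendsto (fun X => (2 * ⌈f X⌉ / q + c) / f X) atTop (𝓝 (2 / q)) := by
  have h := ((tendsto_ceil_div hf).const_mul (2 / q)).add (tendsto_const_div hf c)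
  rw [mul_one, add_zero] at h
  refine h.congr fun X => ?_
  ring

theorem tendsto_residueCount {f : ℝ → ℝ} (hf : Tendsto f atTop atTop) {q : ℤ} (hq : 0 < q)
    (v : ℤ) : Tendsto (fun X => (residueCount ⌈f X⌉ q v : ℝ) / f X) atTop (𝓝 (2 / q)) := by
  refine tendsto_of_tendsto_of_tendsto_of_le_of_le' (tendsto_residueCount_bound hf q (-2))
    (tendsto_residueCount_bound hf q 1) ?_ ?_
  · filter_upwards [hf.eventually_gt_atTop 0] with X hX
    gcongr
    exact le_residueCount hq v
  · filter_upwards [hf.eventually_gt_atTop 0] with X hX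
    gcongr
    exact residueCount_le (Int.ceil_nonneg hX.le) hq v

/-! ### The box of coefficients of bounded height -/

/-- The bound for `A` in the box of height `X`. -/
def boundA (X : ℝ) : ℝ := X ^ (1 / 3 : ℝ)

/-- The bound for `B` in the box of height `X`. -/
def boundB (X : ℝ) : ℝ := X ^ (1 / 2 : ℝ)

theorem tendsto_boundA : Tendsto boundA atTop atTop := tendsto_rpow_atTop (by norm_num)

theorem tendsto_boundB : Tendsto boundB atTop atTop := tendsto_rpow_atTop (by norm_num)

theorem boundA_pow {X : ℝ} (hX : 0 ≤ X) : boundA X ^ 3 = X := by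
  rw [boundA, ← Real.rpow_natCast, ← Real.rpow_mul hX]; norm_num

theorem boundB_pow {X : ℝ} (hX : 0 ≤ X) : boundB X ^ 2 = X := by
  rw [boundB, ← Real.rpow_natCast, ← Real.rpow_mul hX]; norm_num

theorem boundA_nonneg {X : ℝ} (hX : 0 ≤ X) : 0 ≤ boundA X := Real.rpow_nonneg hX _

theorem boundB_nonneg {X : ℝ} (hX : 0 ≤ X) : 0 ≤ boundB X := Real.rpow_nonneg hX _

/-- The integers `(A, B)` with `max (|A|³, |B|²) < X`. -/
def heightBox (X : ℝ) : Finset (ℤ × ℤ) :=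
  Finset.Ioo (-⌈boundA X⌉) ⌈boundA X⌉ ×ˢ Finset.Ioo (-⌈boundB X⌉) ⌈boundB X⌉

theorem mem_Ioo_ceil {x : ℤ} {f : ℝ} : x ∈ Finset.Ioo (-⌈f⌉) ⌈f⌉ ↔ |(x : ℝ)| < f := by
  rw [Finset.mem_Ioo, ← abs_lt, Int.lt_ceil, Int.cast_abs]

theorem mem_heightBox {X : ℝ} (hX : 0 ≤ X) {A B : ℤ} :
    (A, B) ∈ heightBox X ↔ ((max (|A| ^ 3) (|B| ^ 2) : ℤ) : ℝ) < X := by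
  rw [heightBox, Finset.mem_product, mem_Ioo_ceil, mem_Ioo_ceil, Int.cast_max, max_lt_iff]
  push_cast
  refine and_congr ?_ ?_
  · rw [← pow_lt_pow_iff_left₀ (abs_nonneg _) (boundA_nonneg hX) (three_ne_zero), boundA_pow hX]
  · rw [← pow_lt_pow_iff_left₀ (abs_nonneg _) (boundB_nonneg hX) (two_ne_zero), boundB_pow hX]

theorem CurveClass.ext {c c' : CurveClass} (hA : c.A = c'.A) (hB : c.B = c'.B) : c = c' := by
  rw [← c.classOf_curve, ← c'.classOf_curve]
  simp only [CurveClass.curve, hA, hB]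

theorem ncard_belowHeight_le {S : Set CurveClass} {X : ℝ} (hX : 0 ≤ X) {T : Finset (ℤ × ℤ)}
    (hT : ∀ c ∈ S, (c.A, c.B) ∈ heightBox X → (c.A, c.B) ∈ T) :
    (belowHeight S X).ncard ≤ T.card := by
  rw [← Set.ncard_coe_finset]
  refine Set.ncard_le_ncard_of_injOn (fun c => (c.A, c.B)) ?_ ?_ T.finite_toSet
  · rintro c ⟨hc, hh⟩
    exact hT c hc ((mem_heightBox hX).2 hh)
  · intro c _ c' _ h
    rw [Prod.mk.injEq] at h
    exact CurveClass.ext h.1 h.2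

theorem le_ncard_belowHeight {X : ℝ} (hX : 0 ≤ X) {T : Finset (ℤ × ℤ)}
    (hT : T ⊆ heightBox X) (hm : ∀ AB ∈ T, IsMinimalPair AB.1 AB.2) :
    T.card ≤ (belowHeight Set.univ X).ncard := by
  rw [← Set.ncard_coe_finset]
  refine le_trans (Set.ncard_le_ncard (t := (fun c : CurveClass => (c.A, c.B)) ''
    belowHeight Set.univ X) ?_ ((finite_belowHeight _ _).image _))
    (Set.ncard_image_le (finite_belowHeight _ _))
  rintro ⟨A, B⟩ hAB
  have h := hm _ hAB
  obtain ⟨hA, hB⟩ := CurveClass.eq_of_isMinimalPair h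
  refine ⟨classOf _ ((isElliptic_shortCurve_iff _ _).2 h.1), ⟨trivial, ?_⟩, ?_⟩
  · rw [CurveClass.height, hA, hB]
    exact (mem_heightBox hX).1 (hT hAB)
  · simp only [hA, hB]

/-! ### The number of curves of bounded height -/

/-- The pairs of bounded height, different from `(0, 0)`, that are divisible by `n` with
weights `4` and `6`. -/
def divisibleBox (X : ℝ) (n : ℕ) : Finset (ℤ × ℤ) :=
  ((heightBox X).erase 0).filter (fun AB => (n : ℤ) ^ 4 ∣ AB.1 ∧ (n : ℤ) ^ 6 ∣ AB.2)

/-- The added 1 is the erased pair (0, 0), which every n divides. -/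
theorem card_divisibleBox {X : ℝ} (hX : 0 < X) (n : ℕ) :
    (divisibleBox X n).card + 1 =
      residueCount ⌈boundA X⌉ ((n : ℤ) ^ 4) 0 * residueCount ⌈boundB X⌉ ((n : ℤ) ^ 6) 0 := by
  have h0 : (0 : ℤ × ℤ) ∈ (heightBox X).filter
      (fun AB => (n : ℤ) ^ 4 ∣ AB.1 ∧ (n : ℤ) ^ 6 ∣ AB.2) := by
    rw [Finset.mem_filter]
    refine ⟨(mem_heightBox (A := 0) (B := 0) hX.le).2 (by simpa using hX), ?_, ?_⟩ <;> simp
  rw [divisibleBox, Finset.filter_erase, Finset.card_erase_add_one h0, heightBox,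
    Finset.filter_product, Finset.card_product]
  simp only [residueCount, Int.modEq_zero_iff_dvd]

theorem divisibleBox_eq_empty {X : ℝ} (hX : 0 ≤ X) {n : ℕ} (hn : X ≤ (n : ℝ) ^ 12) :
    divisibleBox X n = ∅ := by
  rw [divisibleBox, Finset.filter_eq_empty_iff]
  rintro ⟨A, B⟩ hAB ⟨hA, hB⟩
  simp only at hA hB
  rw [Finset.mem_erase, mem_heightBox hX] at hAB
  obtain ⟨hne, hlt⟩ := hAB
  have key : (((n : ℤ) ^ 12 : ℤ) : ℝ) ≤ ((max (|A| ^ 3) (|B| ^ 2) : ℤ) : ℝ) := by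
    rw [Int.cast_le, le_max_iff]
    by_cases hA0 : A = 0
    · right
      have hB0 : B ≠ 0 := by
        rintro rfl
        exact hne (by rw [hA0]; rfl)
      have := Int.le_of_dvd (abs_pos.2 hB0) ((dvd_abs _ _).2 hB)
      calc (n : ℤ) ^ 12 = ((n : ℤ) ^ 6) ^ 2 := by ring
        _ ≤ _ := pow_le_pow_left₀ (by positivity) this 2
    · left
      have := Int.le_of_dvd (abs_pos.2 hA0) ((dvd_abs _ _).2 hA)
      calc (n : ℤ) ^ 12 = ((n : ℤ) ^ 4) ^ 3 := by ring
        _ ≤ _ := pow_le_pow_left₀ (by positivity) this 3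
  push_cast at key hlt
  linarith

/-- This is the summable majorant, uniform in X, for dominated convergence. The set is empty unless
n¹² < X; then n⁴ and n⁶ are below the two side bounds, and rounding errors are absorbed into a
factor 5 on each side. -/
theorem card_divisibleBox_le {X : ℝ} (hX : 1 ≤ X) {n : ℕ} (hn : 0 < n) :
    ((divisibleBox X n).card : ℝ) ≤ 25 * (1 / (n : ℝ) ^ 10) * (boundA X * boundB X) := by
  have hX0 : 0 ≤ X := by linarith
  have hn' : (0 : ℝ) < n := by exact_mod_cast hn
  have hA1 : 1 ≤ boundA X := Real.one_le_rpow hX (by norm_num)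
  have hB1 : 1 ≤ boundB X := Real.one_le_rpow hX (by norm_num)
  rcases le_or_gt X ((n : ℝ) ^ 12) with h | h
  · rw [divisibleBox_eq_empty hX0 h]
    simp only [Finset.card_empty, Nat.cast_zero]
    positivity
  have aux : ∀ (f : ℝ) (q : ℕ), 1 ≤ f → 0 < q → (q : ℝ) ≤ f →
      (residueCount ⌈f⌉ (q : ℤ) 0 : ℝ) ≤ 5 * (f / q) := by
    intro f q hf hq hqf
    have hq' : (0 : ℝ) < q := by exact_mod_cast hq
    refine (residueCount_le (Int.ceil_nonneg (by linarith)) (by exact_mod_cast hq) 0).trans ?_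
    have h1 := (Int.ceil_lt_add_one f).le
    have h2 : 1 ≤ f / q := by rwa [one_le_div hq']
    have h3 : 2 * (⌈f⌉ : ℝ) / q ≤ 4 * (f / q) := by
      rw [← mul_div_assoc]
      exact div_le_div_of_nonneg_right (by linarith) hq'.le
    push_cast
    linarith
  have hA := aux (boundA X) (n ^ 4) hA1 (by positivity) (by
    rw [← pow_le_pow_iff_left₀ (by positivity) (by positivity) three_ne_zero, boundA_pow hX0]
    push_cast
    rw [← pow_mul]
    exact h.le)
  have hB := aux (boundB X) (n ^ 6) hB1 (by positivity) (by
    rw [← pow_le_pow_iff_left₀ (by positivity) (by positivity) two_ne_zero, boundB_pow hX0]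
    push_cast
    rw [← pow_mul]
    exact h.le)
  have hc := card_divisibleBox (X := X) (by linarith) n
  have hc' : ((divisibleBox X n).card : ℝ) ≤ (residueCount ⌈boundA X⌉ ((n : ℤ) ^ 4) 0 : ℝ) *
      residueCount ⌈boundB X⌉ ((n : ℤ) ^ 6) 0 := by
    rw [← Nat.cast_mul, ← hc]
    push_cast
    linarith
  push_cast at hA hB
  refine hc'.trans ((mul_le_mul hA hB (by positivity) (by positivity)).trans_eq ?_)
  field_simp
  norm_num

theorem tendsto_card_divisibleBox {n : ℕ} (hn : 0 < n) :
    Tendsto (fun X => ((divisibleBox X n).card : ℝ) / (boundA X * boundB X)) atTop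
      (𝓝 (4 * (1 / (n : ℝ) ^ 10))) := by
  have h1 := tendsto_residueCount tendsto_boundA (q := (n : ℤ) ^ 4) (by positivity) 0
  have h2 := tendsto_residueCount tendsto_boundB (q := (n : ℤ) ^ 6) (by positivity) 0
  have h3 := (h1.mul h2).sub (tendsto_const_div
    (tendsto_boundA.atTop_mul_atTop₀ tendsto_boundB) 1)
  have hn' : (n : ℝ) ≠ 0 := by positivity
  rw [show (4 * (1 / (n : ℝ) ^ 10)) = 2 / (((n : ℤ) ^ 4 : ℤ) : ℝ) * (2 / (((n : ℤ) ^ 6 : ℤ) : ℝ)) - 0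
    by push_cast; field_simp; norm_num]
  refine h3.congr' ?_
  filter_upwards [eventually_gt_atTop 0] with X hX
  have hc : ((divisibleBox X n).card : ℝ) + 1 = (residueCount ⌈boundA X⌉ ((n : ℤ) ^ 4) 0 : ℝ) *
      residueCount ⌈boundB X⌉ ((n : ℤ) ^ 6) 0 := by
    exact_mod_cast card_divisibleBox hX n
  rw [eq_sub_of_add_eq hc]
  ring

open scoped Classical in
/-- Möbius inversion: the divisors `n` of `(A, B)` with weights `4` and `6` are the divisors of
a greatest one. -/
theorem sum_moebius_of_weighted_dvd {A B : ℤ} (h0 : (A, B) ≠ 0) {M : ℕ}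
    (hM : ∀ n : ℕ, (n : ℤ) ^ 4 ∣ A → (n : ℤ) ^ 6 ∣ B → n < M) :
    ∑ n ∈ (Finset.range M).filter (fun n : ℕ => (n : ℤ) ^ 4 ∣ A ∧ (n : ℤ) ^ 6 ∣ B),
      ArithmeticFunction.moebius n =
      if ∀ n : ℕ, 1 < n → ¬ ((n : ℤ) ^ 4 ∣ A ∧ (n : ℤ) ^ 6 ∣ B) then 1 else 0 := by
  set S := (Finset.range M).filter (fun n : ℕ => (n : ℤ) ^ 4 ∣ A ∧ (n : ℤ) ^ 6 ∣ B) with hS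
  have hmem : ∀ n : ℕ, n ∈ S ↔ (n : ℤ) ^ 4 ∣ A ∧ (n : ℤ) ^ 6 ∣ B := by
    intro n
    rw [hS, Finset.mem_filter, Finset.mem_range, and_iff_right_iff_imp]
    exact fun h => hM n h.1 h.2
  have h1 : 1 ∈ S := by rw [hmem]; simp
  obtain ⟨g, hgS, hg⟩ := S.exists_max_image id ⟨1, h1⟩
  have hg0 : g ≠ 0 := by
    have := hg 1 h1
    simp only [id] at this
    omega
  -- Closure under lcm makes the largest element g a multiple of all others, so `S` is the divisor
  -- set of g and the Möbius sum detects g = 1.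
  have hlcm : ∀ n ∈ S, Nat.lcm n g ∈ S := by
    intro n hn
    rw [hmem] at hn hgS ⊢
    have aux : ∀ (k : ℕ) (C : ℤ), (n : ℤ) ^ k ∣ C → (g : ℤ) ^ k ∣ C →
        ((Nat.lcm n g : ℕ) : ℤ) ^ k ∣ C := by
      intro k C h h'
      rw [← Nat.cast_pow, Int.natCast_dvd] at h h' ⊢
      rw [← Nat.pow_lcm_pow]
      exact Nat.lcm_dvd h h'
    exact ⟨aux 4 A hn.1 hgS.1, aux 6 B hn.2 hgS.2⟩
  have hSd : S = g.divisors := by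
    ext n
    rw [Nat.mem_divisors]
    constructor
    · intro hn
      refine ⟨?_, hg0⟩
      have hle := hg _ (hlcm n hn)
      simp only [id] at hle
      have hn0 : n ≠ 0 := by
        rintro rfl
        rw [hmem] at hn
        simp only [Nat.cast_zero, ne_eq, OfNat.ofNat_ne_zero, not_false_eq_true, zero_pow,
          zero_dvd_iff] at hn
        exact h0 (by rw [hn.1, hn.2]; rfl)
      have heq : Nat.lcm n g = g := le_antisymm hle
        (Nat.le_of_dvd (Nat.lcm_pos (Nat.pos_of_ne_zero hn0) (Nat.pos_of_ne_zero hg0))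
          (Nat.dvd_lcm_right n g))
      rw [← heq]
      exact Nat.dvd_lcm_left n g
    · rintro ⟨hn, -⟩
      rw [hmem] at hgS ⊢
      have : (n : ℤ) ∣ g := by exact_mod_cast hn
      exact ⟨(pow_dvd_pow_of_dvd this 4).trans hgS.1, (pow_dvd_pow_of_dvd this 6).trans hgS.2⟩
  rw [hSd, ← ArithmeticFunction.coe_mul_zeta_apply, ArithmeticFunction.moebius_mul_coe_zeta,
    ArithmeticFunction.one_apply]
  congr 1
  rw [eq_iff_iff]
  constructor
  · rintro rfl n hn hd
    have := hg n ((hmem n).2 hd)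
    simp only [id] at this
    omega
  · intro h
    by_contra hne
    exact h g (by omega) ((hmem g).1 hgS)

open scoped Classical in
/-- The pairs of bounded height not divisible by any `n > 1` with weights `4` and `6`. -/
def primitiveBox (X : ℝ) : Finset (ℤ × ℤ) :=
  ((heightBox X).erase 0).filter
    (fun AB => ∀ n : ℕ, 1 < n → ¬ ((n : ℤ) ^ 4 ∣ AB.1 ∧ (n : ℤ) ^ 6 ∣ AB.2))

theorem card_primitiveBox {X : ℝ} (hX : 1 ≤ X) :
    ((primitiveBox X).card : ℝ) =
      ∑' n : ℕ, (ArithmeticFunction.moebius n : ℝ) * (divisibleBox X n).card := by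
  classical
  set M := ⌈X⌉₊ with hM
  have hempty : ∀ n : ℕ, M ≤ n → divisibleBox X n = ∅ := by
    intro n hn
    have h1 : X ≤ n := (Nat.le_ceil X).trans (by exact_mod_cast hn)
    refine divisibleBox_eq_empty (by linarith) (h1.trans ?_)
    exact le_self_pow₀ (hX.trans h1) (by norm_num)
  rw [tsum_eq_sum (s := Finset.range M) (fun n hn => by
    rw [Finset.mem_range, not_lt] at hn
    rw [hempty n hn]; simp)]
  have key : ((primitiveBox X).card : ℤ) =
      ∑ n ∈ Finset.range M, ArithmeticFunction.moebius n * (divisibleBox X n).card := by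
    rw [primitiveBox, Finset.card_filter]
    push_cast
    have h : ∀ AB ∈ (heightBox X).erase 0,
        (if ∀ n : ℕ, 1 < n → ¬ ((n : ℤ) ^ 4 ∣ AB.1 ∧ (n : ℤ) ^ 6 ∣ AB.2) then (1 : ℤ) else 0) =
        ∑ n ∈ Finset.range M, if (n : ℤ) ^ 4 ∣ AB.1 ∧ (n : ℤ) ^ 6 ∣ AB.2 then
          ArithmeticFunction.moebius n else 0 := by
      rintro ⟨A, B⟩ hAB
      rw [← Finset.sum_filter, sum_moebius_of_weighted_dvd (Finset.mem_erase.1 hAB).1]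
      intro n hA hB
      by_contra hn
      have : (A, B) ∈ divisibleBox X n := Finset.mem_filter.2 ⟨hAB, hA, hB⟩
      rw [hempty n (not_lt.1 hn)] at this
      exact absurd this (Finset.notMem_empty _)
    rw [Finset.sum_congr rfl h, Finset.sum_comm]
    refine Finset.sum_congr rfl fun n _ => ?_
    rw [divisibleBox, Finset.card_filter]
    push_cast
    rw [Finset.mul_sum]
    refine Finset.sum_congr rfl fun AB _ => ?_
    split_ifs <;> simp
  exact_mod_cast key

theorem zeta_ten_mul_tsum_moebius :
    (riemannZeta 10).re * ∑' n : ℕ, (ArithmeticFunction.moebius n : ℝ) * (1 / (n : ℝ) ^ 10) = 1 := by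
  have h := ArithmeticFunction.LSeries_zeta_mul_Lseries_moebius (s := 10) (by norm_num)
  rw [ArithmeticFunction.LSeries_zeta_eq_riemannZeta (by norm_num)] at h
  have hL : LSeries (fun n => ((ArithmeticFunction.moebius n : ℤ) : ℂ)) 10 =
      ((∑' n : ℕ, (ArithmeticFunction.moebius n : ℝ) * (1 / (n : ℝ) ^ 10) : ℝ) : ℂ) := by
    rw [LSeries, Complex.ofReal_tsum]
    refine tsum_congr fun n => ?_
    rcases eq_or_ne n 0 with rfl | hn
    · simp
    · rw [LSeries.term_of_ne_zero hn]
      push_cast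
      rw [show (10 : ℂ) = ((10 : ℕ) : ℂ) by norm_num, Complex.cpow_natCast]
      ring
  rw [hL] at h
  have := congrArg Complex.re h
  rwa [Complex.re_mul_ofReal, Complex.one_re] at this

/-- The limit passes through the Möbius sum termwise, with majorant 25/n¹⁰; the exponent 10 is the
total weight 4 + 6. -/
theorem tendsto_card_primitiveBox :
    Tendsto (fun X => ((primitiveBox X).card : ℝ) / (boundA X * boundB X)) atTop
      (𝓝 (4 / (riemannZeta 10).re)) := by
  have hz := zeta_ten_mul_tsum_moebius
  have hz0 : (riemannZeta 10).re ≠ 0 := fun h => by rw [h, zero_mul] at hz; exact zero_ne_one hz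
  have hlim : (4 / (riemannZeta 10).re) =
      ∑' n : ℕ, (ArithmeticFunction.moebius n : ℝ) * (4 * (1 / (n : ℝ) ^ 10)) := by
    rw [div_eq_iff hz0]
    simp_rw [mul_left_comm _ (4 : ℝ)]
    rw [tsum_mul_left]
    linear_combination -4 * hz
  rw [hlim]
  have hsum : Summable fun n : ℕ => 25 * (1 / (n : ℝ) ^ 10) :=
    (Real.summable_one_div_nat_pow.2 (by norm_num)).mul_left 25
  refine (tendsto_tsum_of_dominated_convergence (f := fun X n =>
    (ArithmeticFunction.moebius n : ℝ) * (((divisibleBox X n).card : ℝ) / (boundA X * boundB X)))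
    hsum ?_ ?_).congr' ?_
  · intro n
    rcases Nat.eq_zero_or_pos n with rfl | hn
    · simp
    · exact (tendsto_card_divisibleBox hn).const_mul _
  · filter_upwards [eventually_ge_atTop 1] with X hX n
    rcases Nat.eq_zero_or_pos n with rfl | hn
    · simp
    · have hpos : 0 < boundA X * boundB X :=
        mul_pos (Real.rpow_pos_of_pos (by linarith) _) (Real.rpow_pos_of_pos (by linarith) _)
      have hμ : |(ArithmeticFunction.moebius n : ℝ)| ≤ 1 := by
        exact_mod_cast ArithmeticFunction.abs_moebius_le_one
      rw [Real.norm_eq_abs, abs_mul, abs_of_nonneg (a := _ / _) (by positivity)]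
      refine (mul_le_of_le_one_left (by positivity) hμ).trans ?_
      rw [div_le_iff₀ hpos]
      exact card_divisibleBox_le hX hn
  · filter_upwards [eventually_ge_atTop 1] with X hX
    rw [card_primitiveBox hX, ← tsum_div_const]
    simp_rw [mul_div_assoc]

open scoped Classical in
/-- There are few singular pairs of bounded height. -/
theorem card_singular_le (X : ℝ) :
    ((heightBox X).filter (fun AB => 4 * AB.1 ^ 3 + 27 * AB.2 ^ 2 = 0)).card ≤
      residueCount ⌈boundB X⌉ 1 0 := by
  refine Finset.card_le_card_of_injOn Prod.snd ?_ ?_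
  · rintro ⟨A, B⟩ h
    simp only [heightBox, Finset.coe_filter, Set.mem_ofPred_eq, Finset.mem_product] at h ⊢
    exact ⟨h.1.2, Int.modEq_one⟩
  · rintro ⟨A, B⟩ h ⟨A', B'⟩ h' hB
    simp only [Finset.coe_filter, Set.mem_ofPred_eq] at h h' hB
    subst hB
    have : A ^ 3 = A' ^ 3 := by linarith [h.2, h'.2]
    rw [(Odd.pow_inj (R := ℤ) (n := 3) (by decide)).1 this]

theorem tendsto_lower_bound :
    Tendsto (fun X => (((primitiveBox X).card : ℝ) - residueCount ⌈boundB X⌉ 1 0) /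
      (boundA X * boundB X)) atTop (𝓝 (4 / (riemannZeta 10).re)) := by
  have h := tendsto_card_primitiveBox.sub ((tendsto_const_div tendsto_boundA 1).mul
    (tendsto_residueCount tendsto_boundB (q := 1) one_pos 0))
  rw [zero_mul, sub_zero] at h
  refine h.congr fun X => ?_
  ring

theorem lower_bound_le {X : ℝ} (hX : 0 ≤ X) :
    ((primitiveBox X).card : ℝ) - residueCount ⌈boundB X⌉ 1 0 ≤
      (belowHeight Set.univ X).ncard := by
  classical
  rw [sub_le_iff_le_add]
  have h := le_ncard_belowHeight (X := X) hX
    (T := primitiveBox X \ (heightBox X).filter (fun AB => 4 * AB.1 ^ 3 + 27 * AB.2 ^ 2 = 0))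
    (Finset.sdiff_subset.trans ((Finset.filter_subset _ _).trans (Finset.erase_subset _ _))) (by
      rintro ⟨A, B⟩ hAB
      rw [Finset.mem_sdiff, primitiveBox, Finset.mem_filter, Finset.mem_filter] at hAB
      refine ⟨fun h => hAB.2 ⟨Finset.mem_of_mem_erase hAB.1.1, h⟩, fun n hn hd => ?_⟩
      exact hAB.1.2 n hn ((pow_dvd_gcd_iff _ _ _).1 hd))
  have h2 := Finset.le_card_sdiff
    ((heightBox X).filter (fun AB => 4 * AB.1 ^ 3 + 27 * AB.2 ^ 2 = 0)) (primitiveBox X)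
  have h3 := card_singular_le X
  have : (primitiveBox X).card ≤ (belowHeight Set.univ X).ncard + residueCount ⌈boundB X⌉ 1 0 := by
    refine (tsub_le_iff_right.1 h2).trans (add_le_add h ?_)
    convert h3
  exact_mod_cast this

/-- An asymptotic upper bound for the number of curves in `S` bounds the upper density of `S`. -/
theorem upperDensity_le {S : Set CurveClass} {U : ℝ → ℝ} {c : ℝ}
    (hU : ∀ᶠ X in atTop, ((belowHeight S X).ncard : ℝ) ≤ U X)
    (hlim : Tendsto (fun X => U X / (boundA X * boundB X)) atTop (𝓝 (4 * c))) :
    upperDensity S ≤ (riemannZeta 10).re * c := by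
  have hz := zeta_ten_mul_tsum_moebius
  have hz0 : (riemannZeta 10).re ≠ 0 := fun h => by rw [h, zero_mul] at hz; exact zero_ne_one hz
  -- Positivity comes for free: this is a nonzero limit of nonnegative ratios.
  have hzpos : 0 < 4 / (riemannZeta 10).re := by
    refine lt_of_le_of_ne ?_ (by positivity)
    refine ge_of_tendsto tendsto_card_primitiveBox ?_
    filter_upwards [eventually_ge_atTop 0] with X hX
    exact div_nonneg (Nat.cast_nonneg _) (mul_nonneg (boundA_nonneg hX) (boundB_nonneg hX))
  have hlow := tendsto_lower_bound
  have hq := hlim.div hlow hzpos.ne'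
  rw [show 4 * c / (4 / (riemannZeta 10).re) = (riemannZeta 10).re * c by field_simp] at hq
  rw [upperDensity, ← hq.limsup_eq]
  refine limsup_le_limsup ?_ (isCoboundedUnder_le_of_le atTop (x := 0) fun X => by positivity)
    hq.isBoundedUnder_le
  filter_upwards [hU, eventually_ge_atTop 1, hlow.eventually (eventually_gt_nhds hzpos)] with X hUX hX hpos
  have hb : 0 < boundA X * boundB X :=
    mul_pos (Real.rpow_pos_of_pos (by linarith) _) (Real.rpow_pos_of_pos (by linarith) _)
  simp only [Pi.div_apply]
  rw [div_div_div_cancel_right₀ hb.ne']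
  rw [div_pos_iff_of_pos_right hb] at hpos
  exact div_le_div₀ ((Nat.cast_nonneg _).trans hUX) hUX hpos (lower_bound_le (by linarith))

/-! ### Curves with a point of order `p` on the reduction modulo `p` -/

/-- Without an element of order p only 0 is killed by p, and p does not divide 1. -/
theorem exists_addOrderOf_eq {G : Type*} [AddGroup G] {p : ℕ} (hp : p.Prime)
    (h : p ∣ Nat.card {P : G // p • P = 0}) : ∃ P : G, addOrderOf P = p := by
  by_contra! hcon
  have : Fact p.Prime := ⟨hp⟩
  have h0 : ∀ P : G, p • P = 0 → P = 0 := by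
    intro P hP
    by_contra hne
    exact hcon P (addOrderOf_eq_prime hP hne)
  have : Unique {P : G // p • P = 0} :=
    ⟨⟨⟨0, smul_zero p⟩⟩, fun P => Subtype.ext (h0 P.1 P.2)⟩
  rw [Nat.card_unique] at h
  exact hp.not_dvd_one h

theorem upperDensity_anomalousSet_le (p : ℕ) [Fact p.Prime] :
    upperDensity (anomalousSet p) ≤ (riemannZeta 10).re * ((dCount p : ℝ) / (p : ℝ) ^ 2) := by
  classical
  have hp : p.Prime := Fact.out
  have hp0 : (0 : ℤ) < p := by exact_mod_cast hp.pos
  set D : Set (ZMod p × ZMod p) := {κ : ZMod p × ZMod p | 4 * κ.1 ^ 3 + 27 * κ.2 ^ 2 ≠ 0 ∧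
    ∃ P : (shortCurve κ.1 κ.2).toAffine.Point, addOrderOf P = p} with hD
  have hd : dCount p = (Set.toFinite D).toFinset.card := by
    rw [← Set.ncard_eq_toFinset_card]; rfl
  have hmod : ∀ (x : ℤ) (κ : ZMod p), (x : ZMod p) = κ → x ≡ (κ.val : ℤ) [ZMOD p] := by
    rintro x κ rfl
    rw [← ZMod.intCast_eq_intCast_iff]
    simp
  refine upperDensity_le (U := fun X => (dCount p : ℝ) * ((2 * ⌈boundA X⌉ / (p : ℝ) + 1) *
    (2 * ⌈boundB X⌉ / (p : ℝ) + 1))) ?_ ?_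
  · filter_upwards [eventually_ge_atTop 0] with X hX
    set T : Finset (ℤ × ℤ) := (Set.toFinite D).toFinset.biUnion fun κ =>
      ((Finset.Ioo (-⌈boundA X⌉) ⌈boundA X⌉).filter (fun x => x ≡ (κ.1.val : ℤ) [ZMOD p])) ×ˢ
      ((Finset.Ioo (-⌈boundB X⌉) ⌈boundB X⌉).filter (fun x => x ≡ (κ.2.val : ℤ) [ZMOD p])) with hT
    have h1 : (belowHeight (anomalousSet p) X).ncard ≤ T.card := by
      refine ncard_belowHeight_le hX ?_
      rintro c ⟨hgood, hdvd⟩ hbox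
      rw [hT, Finset.mem_biUnion]
      refine ⟨((c.A : ZMod p), (c.B : ZMod p)), ?_, ?_⟩
      · rw [Set.Finite.mem_toFinset]
        refine ⟨fun h => ?_, exists_addOrderOf_eq hp hdvd⟩
        have hu := ((c.reductionMod p).isElliptic_iff).1 hgood
        rw [CurveClass.reductionMod, shortCurve_Δ, h, mul_zero] at hu
        exact not_isUnit_zero hu
      · rw [heightBox, Finset.mem_product] at hbox
        rw [Finset.mem_product, Finset.mem_filter, Finset.mem_filter]
        exact ⟨⟨hbox.1, hmod _ _ rfl⟩, hbox.2, hmod _ _ rfl⟩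
    have h2 : (T.card : ℝ) ≤ ∑ κ ∈ (Set.toFinite D).toFinset,
        ((2 * ⌈boundA X⌉ / (p : ℝ) + 1) * (2 * ⌈boundB X⌉ / (p : ℝ) + 1)) := by
      have h3 : (T.card : ℝ) ≤ ((∑ κ ∈ (Set.toFinite D).toFinset,
          residueCount ⌈boundA X⌉ p κ.1.val * residueCount ⌈boundB X⌉ p κ.2.val : ℕ) : ℝ) := by
        rw [Nat.cast_le]
        refine Finset.card_biUnion_le.trans (le_of_eq (Finset.sum_congr rfl fun κ _ => ?_))
        rw [Finset.card_product]
        rfl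
      refine h3.trans ?_
      push_cast
      refine Finset.sum_le_sum fun κ _ => ?_
      have hA := residueCount_le (Int.ceil_nonneg (boundA_nonneg hX)) hp0 κ.1.val
      have hB := residueCount_le (Int.ceil_nonneg (boundB_nonneg hX)) hp0 κ.2.val
      exact mul_le_mul hA hB (Nat.cast_nonneg _) ((Nat.cast_nonneg _).trans hA)
    rw [Finset.sum_const, nsmul_eq_mul, ← hd] at h2
    exact (Nat.cast_le.2 h1).trans h2
  · have h := ((tendsto_residueCount_bound tendsto_boundA (p : ℝ) 1).mul
      (tendsto_residueCount_bound tendsto_boundB (p : ℝ) 1)).const_mul (dCount p : ℝ)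
    rw [show 4 * ((dCount p : ℝ) / (p : ℝ) ^ 2) = dCount p * (2 / (p : ℝ) * (2 / p)) by ring]
    refine h.congr fun X => ?_
    ring

/-! ### Curves with Tamagawa number divisible by `p` -/

theorem deepModulus_pos (p : ℕ) {l : ℕ} (hl : l.Prime) : 0 < deepModulus p l := by
  have := hl.pos
  rw [deepModulus]
  split_ifs <;> positivity

open scoped Classical in
-- In a nonempty fibre over A, one member B₀ confines all others to the classes of ±B₀ modulo
-- `deepModulus p l`; the inner factor 2 counts the signs.
theorem card_isDeepMultiplicative_le {p l : ℕ} (hp5 : 5 ≤ p) (hl : l.Prime) {X : ℝ} (hX : 0 ≤ X) :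
    (((heightBox X).filter
      (fun AB => IsMinimalPair AB.1 AB.2 ∧ IsDeepMultiplicative p l AB.1 AB.2)).card : ℝ) ≤
      2 * ⌈boundA X⌉ * (2 * (2 * ⌈boundB X⌉ / (deepModulus p l : ℝ) + 1)) := by
  set T := (heightBox X).filter
    (fun AB => IsMinimalPair AB.1 AB.2 ∧ IsDeepMultiplicative p l AB.1 AB.2) with hT
  have hq : (0 : ℤ) < deepModulus p l := by exact_mod_cast deepModulus_pos p hl
  have ha := Int.ceil_nonneg (boundA_nonneg hX)
  have hb := Int.ceil_nonneg (boundB_nonneg hX)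
  have hb' : (0 : ℝ) ≤ ⌈boundB X⌉ := by exact_mod_cast hb
  have hfib : ∀ A ∈ Finset.Ioo (-⌈boundA X⌉) ⌈boundA X⌉,
      ((T.filter (fun AB => AB.1 = A)).card : ℝ) ≤
        2 * (2 * ⌈boundB X⌉ / (deepModulus p l : ℝ) + 1) := by
    intro A _
    rcases (T.filter (fun AB => AB.1 = A)).eq_empty_or_nonempty with h | ⟨⟨A₀, B₀⟩, h₀⟩
    · rw [h, Finset.card_empty, Nat.cast_zero]
      positivity
    rw [Finset.mem_filter, hT, Finset.mem_filter] at h₀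
    obtain ⟨⟨-, hm₀, hd₀⟩, rfl⟩ := h₀
    have hcard : (T.filter (fun AB => AB.1 = A₀)).card ≤
        residueCount ⌈boundB X⌉ (deepModulus p l) B₀ +
          residueCount ⌈boundB X⌉ (deepModulus p l) (-B₀) := by
      rw [residueCount, residueCount]
      refine le_trans (Finset.card_le_card_of_injOn Prod.snd (t := _ ∪ _) ?_ ?_)
        (Finset.card_union_le _ _)
      · rintro ⟨A, B⟩ h
        rw [Finset.mem_coe, Finset.mem_filter, hT, Finset.mem_filter, heightBox,
          Finset.mem_product] at h
        obtain ⟨⟨hbox, hm, hd⟩, rfl⟩ := h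
        rw [Finset.mem_coe, Finset.mem_union, Finset.mem_filter, Finset.mem_filter]
        rcases hd₀.dvd_sub_or_dvd_add hp5 hl hm₀ hm hd with h | h
        · exact Or.inl ⟨hbox.2, Int.modEq_iff_dvd.2 h⟩
        · refine Or.inr ⟨hbox.2, Int.modEq_iff_dvd.2 ?_⟩
          rw [show -B₀ - (A, B).2 = -(B₀ + B) by ring]
          exact h.neg_right
      · rintro ⟨A, B⟩ h ⟨A', B'⟩ h' hB
        rw [Finset.mem_coe, Finset.mem_filter] at h h'
        exact Prod.ext (h.2.trans h'.2.symm) hB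
    have h1 := residueCount_le hb hq B₀
    have h2 := residueCount_le hb hq (-B₀)
    have h3 : ((T.filter (fun AB => AB.1 = A₀)).card : ℝ) ≤
        residueCount ⌈boundB X⌉ (deepModulus p l) B₀ +
          residueCount ⌈boundB X⌉ (deepModulus p l) (-B₀) := by exact_mod_cast hcard
    rw [Int.cast_natCast] at h1 h2
    linarith
  have hcard : T.card = ∑ A ∈ Finset.Ioo (-⌈boundA X⌉) ⌈boundA X⌉,
      (T.filter (fun AB => AB.1 = A)).card :=
    Finset.card_eq_sum_card_fiberwise fun AB hAB =>
      (Finset.mem_product.1 (Finset.mem_filter.1 hAB).1).1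
  rw [hcard, Nat.cast_sum]
  refine (Finset.sum_le_sum hfib).trans ?_
  rw [Finset.sum_const, nsmul_eq_mul]
  refine mul_le_mul_of_nonneg_right ?_ (by positivity)
  have : ((Finset.Ioo (-⌈boundA X⌉) ⌈boundA X⌉).card : ℤ) ≤ 2 * ⌈boundA X⌉ := by
    rw [Int.card_Ioo]
    omega
  exact_mod_cast this

/-- The bound for the primes at which a curve of height less than `X` can have large discriminant
valuation. -/
def boundL (X : ℝ) : ℝ := 31 * X ^ (1 / 4 : ℝ)

theorem lt_of_isDeepMultiplicative {p l : ℕ} (hp5 : 5 ≤ p) (hl : l.Prime) {X : ℝ} (hX : 0 ≤ X)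
    {A B : ℤ} (hm : IsMinimalPair A B) (h : IsDeepMultiplicative p l A B)
    (hbox : (A, B) ∈ heightBox X) : l < ⌊boundL X⌋₊ + 1 := by
  rw [Nat.lt_add_one_iff]
  have hL0 : 0 ≤ boundL X := by unfold boundL; positivity
  refine Nat.le_floor ?_
  have h1 := Int.le_of_dvd (abs_pos.2 hm.1) ((dvd_abs _ _).2 (h.pow_four_dvd hp5 hl hm))
  have h2 : |4 * A ^ 3 + 27 * B ^ 2| ≤ 31 * max (|A| ^ 3) (|B| ^ 2) := by
    have e1 := le_max_left (|A| ^ 3) (|B| ^ 2)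
    have e2 := le_max_right (|A| ^ 3) (|B| ^ 2)
    refine (abs_add_le _ _).trans ?_
    rw [abs_mul, abs_mul, abs_pow, abs_pow, show |(4 : ℤ)| = 4 from rfl, show |(27 : ℤ)| = 27 from rfl]
    linarith
  rw [mem_heightBox hX] at hbox
  have h3 : (((l : ℤ) ^ 4 : ℤ) : ℝ) ≤ ((31 * max (|A| ^ 3) (|B| ^ 2) : ℤ) : ℝ) :=
    Int.cast_le.2 (h1.trans h2)
  -- Here 31 = 4 + 27 bounds the discriminant by 31X; using 31 rather than its fourth root in
  -- `boundL` is harmless slack.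
  have hL : boundL X ^ 4 = 31 ^ 4 * X := by
    rw [boundL, mul_pow, ← Real.rpow_natCast, ← Real.rpow_natCast, ← Real.rpow_mul hX]
    norm_num
  rw [← pow_le_pow_iff_left₀ (Nat.cast_nonneg _) hL0 (four_ne_zero), hL]
  rw [Int.cast_mul] at h3
  push_cast at h3 hbox
  nlinarith

/-- The union bound over l up to `boundL X` has main term 4s·ab. The rounding errors total O(X^(1/3
+ 1/4)), which is o(X^(5/6)). -/
theorem upperDensity_tamagawaSet_le_of_sum_le {p : ℕ} (hp : p.Prime) (hp5 : 5 ≤ p) {s : ℝ}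
    (hs : ∀ N : ℕ, ∑ l ∈ (Finset.range N).filter Nat.Prime, 2 / (deepModulus p l : ℝ) ≤ s) :
    upperDensity (tamagawaSet p) ≤ (riemannZeta 10).re * s := by
  classical
  refine upperDensity_le (U := fun X => 2 * ⌈boundA X⌉ * (2 * ⌈boundB X⌉ * s +
    2 * (boundL X + 1))) ?_ ?_
  · filter_upwards [eventually_ge_atTop 0] with X hX
    have ha' : (0 : ℝ) ≤ ⌈boundA X⌉ := by exact_mod_cast Int.ceil_nonneg (boundA_nonneg hX)
    have hb' : (0 : ℝ) ≤ ⌈boundB X⌉ := by exact_mod_cast Int.ceil_nonneg (boundB_nonneg hX)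
    have hL0 : 0 ≤ boundL X := by unfold boundL; positivity
    set P := (Finset.range (⌊boundL X⌋₊ + 1)).filter Nat.Prime with hP
    set T : ℕ → Finset (ℤ × ℤ) := fun l => (heightBox X).filter
      (fun AB => IsMinimalPair AB.1 AB.2 ∧ IsDeepMultiplicative p l AB.1 AB.2) with hT
    have h1 : (belowHeight (tamagawaSet p) X).ncard ≤ (P.biUnion T).card := by
      refine ncard_belowHeight_le hX fun c hc hbox => ?_
      obtain ⟨l, hl, hd⟩ := exists_isDeepMultiplicative hp hp5 hc
      have hm := c.isMinimalPair
      rw [Finset.mem_biUnion]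
      exact ⟨l, Finset.mem_filter.2 ⟨Finset.mem_range.2
        (lt_of_isDeepMultiplicative hp5 hl hX hm hd hbox), hl⟩,
        Finset.mem_filter.2 ⟨hbox, hm, hd⟩⟩
    have h2 : ((P.biUnion T).card : ℝ) ≤ ∑ l ∈ P, ((T l).card : ℝ) := by
      exact_mod_cast Finset.card_biUnion_le
    have h3 : ∑ l ∈ P, ((T l).card : ℝ) ≤ ∑ l ∈ P,
        2 * ⌈boundA X⌉ * (2 * (2 * ⌈boundB X⌉ / (deepModulus p l : ℝ) + 1)) :=
      Finset.sum_le_sum fun l hl => card_isDeepMultiplicative_le hp5 (Finset.mem_filter.1 hl).2 hX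
    have h4 : ∑ l ∈ P, 2 * (⌈boundA X⌉ : ℝ) *
        (2 * (2 * ⌈boundB X⌉ / (deepModulus p l : ℝ) + 1)) =
        2 * ⌈boundA X⌉ * (2 * ⌈boundB X⌉ * ∑ l ∈ P, 2 / (deepModulus p l : ℝ) + 2 * P.card) := by
      rw [mul_comm (2 : ℝ) (P.card : ℝ), ← nsmul_eq_mul, ← Finset.sum_const,
        Finset.mul_sum, ← Finset.sum_add_distrib, Finset.mul_sum]
      refine Finset.sum_congr rfl fun l _ => ?_
      ring
    have h5 : (P.card : ℝ) ≤ boundL X + 1 := by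
      have : P.card ≤ ⌊boundL X⌋₊ + 1 :=
        (Finset.card_filter_le _ _).trans (Finset.card_range _).le
      have h' := Nat.floor_le hL0
      have h'' : (P.card : ℝ) ≤ (⌊boundL X⌋₊ : ℝ) + 1 := by exact_mod_cast this
      linarith
    refine (Nat.cast_le.2 h1).trans (h2.trans (h3.trans (h4.trans_le ?_)))
    have h6 := hs (⌊boundL X⌋₊ + 1)
    gcongr
  · have hLB : Tendsto (fun X => boundL X / boundB X) atTop (𝓝 0) := by
      have h := (tendsto_rpow_neg_atTop (show (0 : ℝ) < 1 / 4 by norm_num)).const_mul 31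
      rw [mul_zero] at h
      refine h.congr' ?_
      filter_upwards [eventually_gt_atTop 0] with X hX
      rw [boundL, boundB, mul_div_assoc, ← Real.rpow_sub hX]
      norm_num
    have h := ((tendsto_ceil_div tendsto_boundA).const_mul 2).mul
      ((((tendsto_ceil_div tendsto_boundB).const_mul 2).mul_const s).add
        ((hLB.add (tendsto_const_div tendsto_boundB 1)).const_mul 2))
    rw [show 2 * 1 * (2 * 1 * s + 2 * (0 + 0)) = 4 * s by ring] at h
    refine h.congr fun X => ?_
    ring

/-! ### Numerical estimates -/

/-- The crude comparison with ζ(4) = π⁴/90 suffices, because 1.083·0.9 < 1. -/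
theorem zeta_ten_le : (riemannZeta 10).re ≤ 1083 / 1000 := by
  have h10 : (riemannZeta 10).re = ∑' n : ℕ, 1 / (n : ℝ) ^ 10 := by
    have h := zeta_nat_eq_tsum_of_gt_one (k := 10) (by norm_num)
    have h' : (∑' n : ℕ, 1 / (n : ℂ) ^ 10) = ((∑' n : ℕ, 1 / (n : ℝ) ^ 10 : ℝ) : ℂ) := by
      rw [Complex.ofReal_tsum]
      push_cast
      rfl
    rw [h'] at h
    have h'' := congrArg Complex.re h
    rw [Complex.ofReal_re] at h''
    exact_mod_cast h''
  have hle : (riemannZeta 10).re ≤ Real.pi ^ 4 / 90 := by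
    rw [h10, ← hasSum_zeta_four.tsum_eq]
    refine Summable.tsum_le_tsum (fun n => ?_) (Real.summable_one_div_nat_pow.2 (by norm_num))
      hasSum_zeta_four.summable
    rcases Nat.eq_zero_or_pos n with rfl | hn
    · simp
    · have : (1 : ℝ) ≤ n := by exact_mod_cast hn
      gcongr
      norm_num
  have hpi : Real.pi ^ 4 ≤ 3.1416 ^ 4 :=
    pow_le_pow_left₀ Real.pi_pos.le Real.pi_lt_d4.le 4
  norm_num at hpi
  linarith

/-- By convexity the midpoint value at m = 2j + 7 is at most half the integral of t⁻⁴ over [m - 1, m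
+ 1], and these integrals telescope from 6, whence 216 = 6³. -/
theorem sum_odd_inv_pow_four_le (N : ℕ) :
    ∑ j ∈ Finset.range N, 1 / (2 * (j : ℝ) + 7) ^ 4 ≤
      1 / 6 * (1 / 216 - 1 / (2 * (N : ℝ) + 6) ^ 3) := by
  induction N with
  | zero => norm_num
  | succ N ih =>
    rw [Finset.sum_range_succ]
    have hN : (0 : ℝ) ≤ N := Nat.cast_nonneg N
    have key : 1 / (2 * (N : ℝ) + 7) ^ 4 ≤
        1 / 6 * (1 / (2 * (N : ℝ) + 6) ^ 3 - 1 / (2 * (N : ℝ) + 8) ^ 3) := by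
      rw [div_sub_div _ _ (by positivity) (by positivity), ← mul_div_assoc,
        div_le_div_iff₀ (by positivity) (by positivity)]
      obtain ⟨m, hm⟩ : ∃ m : ℝ, m = 2 * (N : ℝ) + 7 := ⟨_, rfl⟩
      rw [show 2 * (N : ℝ) + 6 = m - 1 by rw [hm]; ring,
        show 2 * (N : ℝ) + 8 = m + 1 by rw [hm]; ring, ← hm]
      nlinarith [sq_nonneg m, sq_nonneg (m ^ 2), sq_nonneg (m ^ 2 - 1)]
    push_cast
    rw [show 2 * ((N : ℝ) + 1) + 6 = 2 * (N : ℝ) + 8 by ring]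
    linarith

/-- The total density of the exceptional residue classes. -/
theorem sum_deepModulus_le {p : ℕ} (hp5 : 5 ≤ p) (N : ℕ) :
    ∑ l ∈ (Finset.range N).filter Nat.Prime, 2 / (deepModulus p l : ℝ) ≤
      9 / 10 * (1 / 2 ^ (p + 2)) := by
  obtain ⟨m, rfl⟩ := Nat.exists_eq_add_of_le hp5
  -- Writing p = 5 + m, the estimate l^m ≥ 2^m extracts 2^(-(p+2)) from every term, with 256 = 2·2⁷.
  -- What remains is independent of p: 1/4 + 1/100 + 256/625 + 256/1296 < 9/10.
  have hlarge : ∀ l : ℕ, 5 ≤ l → 2 / (deepModulus (5 + m) l : ℝ) ≤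
      256 * (1 / (l : ℝ) ^ 4) * (1 / 2 ^ (5 + m + 2)) := by
    intro l hl
    have hl' : (2 : ℝ) ≤ l := by exact_mod_cast (by omega : 2 ≤ l)
    have h1 : (2 : ℝ) ^ m ≤ (l : ℝ) ^ m := by gcongr
    rw [deepModulus, if_neg (by omega), if_neg (by omega),
      show 5 + m - 1 = 4 + m by omega]
    push_cast
    rw [show 256 * (1 / (l : ℝ) ^ 4) * (1 / 2 ^ (5 + m + 2)) = 2 / ((l : ℝ) ^ 4 * 2 ^ m) by
      rw [pow_add, pow_add]; field_simp; norm_num, pow_add]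
    gcongr
  set P := (Finset.range N).filter Nat.Prime with hP
  rw [← Finset.sum_filter_add_sum_filter_not P (fun l => l < 7)]
  have hsmall : ∑ l ∈ P.filter (fun l => l < 7), 2 / (deepModulus (5 + m) l : ℝ) ≤
      (1 / 4 + 1 / 100 + 256 / 625) * (1 / 2 ^ (5 + m + 2)) := by
    have hsub : P.filter (fun l => l < 7) ⊆ {2, 3, 5} := by
      intro l hl
      rw [Finset.mem_filter, hP, Finset.mem_filter] at hl
      obtain ⟨⟨-, hl⟩, h7⟩ := hl
      interval_cases l <;> revert hl <;> decide
    refine (Finset.sum_le_sum_of_subset_of_nonneg hsub fun _ _ _ => by positivity).trans ?_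
    rw [Finset.sum_insert (by decide), Finset.sum_insert (by decide), Finset.sum_singleton]
    have h5 := hlarge 5 le_rfl
    have h2 : 2 / (deepModulus (5 + m) 2 : ℝ) = 1 / 4 * (1 / 2 ^ (5 + m + 2)) := by
      rw [deepModulus, if_pos rfl]
      push_cast
      rw [pow_add _ (5 + m), pow_add _ (5 + m)]
      field_simp
      norm_num
    have h3 : 2 / (deepModulus (5 + m) 3 : ℝ) ≤ 1 / 100 * (1 / 2 ^ (5 + m + 2)) := by
      rw [deepModulus, if_neg (by norm_num), if_pos rfl]
      push_cast
      have h1 : (2 : ℝ) ^ m ≤ 3 ^ m := by gcongr; norm_num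
      have h0 : (0 : ℝ) < 2 ^ m := by positivity
      rw [show (3 : ℝ) ^ (5 + m + 5) = 59049 * 3 ^ m by ring,
        show (2 : ℝ) ^ (5 + m + 2) = 128 * 2 ^ m by ring, div_mul_div_comm,
        div_le_div_iff₀ (by positivity) (by positivity)]
      linarith
    norm_num at h5
    norm_num at h2 h3 ⊢
    linarith
  have hbig : ∑ l ∈ P.filter (fun l => ¬ l < 7), 2 / (deepModulus (5 + m) l : ℝ) ≤
      256 / 1296 * (1 / 2 ^ (5 + m + 2)) := by
    have hsub : P.filter (fun l => ¬ l < 7) ⊆ (Finset.range N).image (fun j => 2 * j + 7) := by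
      intro l hl
      rw [Finset.mem_filter, hP, Finset.mem_filter, Finset.mem_range] at hl
      obtain ⟨⟨hN, hl⟩, h7⟩ := hl
      obtain ⟨k, hk⟩ := hl.odd_of_ne_two (by omega)
      rw [Finset.mem_image]
      exact ⟨k - 3, by rw [Finset.mem_range]; omega, by omega⟩
    refine (Finset.sum_le_sum_of_subset_of_nonneg hsub fun _ _ _ => by positivity).trans ?_
    rw [Finset.sum_image (fun i _ j _ h => by omega)]
    refine (Finset.sum_le_sum fun j _ => hlarge (2 * j + 7) (by omega)).trans ?_
    rw [← Finset.sum_mul, ← Finset.mul_sum]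
    refine mul_le_mul_of_nonneg_right ?_ (by positivity)
    have h := sum_odd_inv_pow_four_le N
    have h' : 0 ≤ 1 / (2 * (N : ℝ) + 6) ^ 3 := by positivity
    push_cast
    linarith
  have hpos : (0 : ℝ) < 1 / 2 ^ (5 + m + 2) := by positivity
  nlinarith

theorem summable_tamagawa_bound {p : ℕ} (hp5 : 5 ≤ p) :
    Summable (fun l : {l : Nat.Primes // (l : ℕ) ≠ p} =>
      (((l : ℕ) : ℝ) - 1) ^ 2 / ((l : ℕ) : ℝ) ^ (p + 2)) := by
  have hinj : Function.Injective (fun l : {l : Nat.Primes // (l : ℕ) ≠ p} => ((l : Nat.Primes) : ℕ)) :=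
    fun l l' h => Subtype.ext (Subtype.ext h)
  refine Summable.of_nonneg_of_le (fun l => by positivity) (fun l => ?_)
    ((Real.summable_one_div_nat_pow.2 one_lt_two).comp_injective hinj)
  have hl : (1 : ℝ) ≤ ((l : ℕ) : ℝ) := by exact_mod_cast l.1.2.one_le
  simp only [Function.comp]
  rw [div_le_div_iff₀ (by positivity) (by positivity), one_mul]
  calc (((l : ℕ) : ℝ) - 1) ^ 2 * ((l : ℕ) : ℝ) ^ 2
      ≤ ((l : ℕ) : ℝ) ^ 2 * ((l : ℕ) : ℝ) ^ 2 := by gcongr; linarith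
    _ = ((l : ℕ) : ℝ) ^ 4 := by ring
    _ ≤ _ := pow_le_pow_right₀ hl (by omega)

/-- The single term l = 2, equal to 2^(-(p+2)) and present because p ≠ 2, already dominates the
density; the other terms are only used to be nonnegative. -/
theorem upperDensity_tamagawaSet_le {p : ℕ} (hp : p.Prime) (hp5 : 5 ≤ p) :
    upperDensity (tamagawaSet p) ≤ ∑' l : {l : Nat.Primes // (l : ℕ) ≠ p},
      (((l : ℕ) : ℝ) - 1) ^ 2 / ((l : ℕ) : ℝ) ^ (p + 2) := by
  have h := upperDensity_tamagawaSet_le_of_sum_le hp hp5 (sum_deepModulus_le hp5)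
  have h2 := (summable_tamagawa_bound hp5).le_tsum
    (⟨⟨2, Nat.prime_two⟩, show 2 ≠ p by omega⟩ : {l : Nat.Primes // (l : ℕ) ≠ p})
    (fun l _ => by positivity)
  refine (h.trans ?_).trans h2
  have hpos : (0 : ℝ) < 1 / 2 ^ (p + 2) := by positivity
  have hz := zeta_ten_le
  push_cast
  rw [show ((2 : ℝ) - 1) ^ 2 = 1 by norm_num]
  nlinarith

end EllipticDensity

end

theorem theorem4p2 (p : ℕ) [Fact p.Prime] (hp : 5 ≤ p) :
    (Summable (fun l : {l : Nat.Primes // (l : ℕ) ≠ p} =>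
        (((l : ℕ) : ℝ) - 1) ^ 2 / ((l : ℕ) : ℝ) ^ (p + 2)) ∧
      EllipticDensity.upperDensity (EllipticDensity.tamagawaSet p) ≤
        ∑' l : {l : Nat.Primes // (l : ℕ) ≠ p},
          (((l : ℕ) : ℝ) - 1) ^ 2 / ((l : ℕ) : ℝ) ^ (p + 2)) ∧
    EllipticDensity.upperDensity (EllipticDensity.anomalousSet p) ≤
      (riemannZeta 10).re * (EllipticDensity.dCount p : ℝ) / (p : ℝ) ^ 2 := by
  refine ⟨⟨EllipticDensity.summable_tamagawa_bound hp,
    EllipticDensity.upperDensity_tamagawaSet_le Fact.out hp⟩, ?_⟩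
  rw [mul_div_assoc]
  exact EllipticDensity.upperDensity_anomalousSet_le p
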